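/- Polygons lie in the Euclidean plane, vertices $v_0,\dots,v_{63}$ are listed counterclockwise with indices modulo $64$, and $L$ denotes perimeter. A polygon is small if its diameter (largest distance between two vertices) is $1$; the diameter graph of a small polygon joins two vertices when their distance is $1$. All polygons below are symmetric in the vertical axis, $v_{64-i}$ being the mirror image of $v_i$, with $v_0=(0,0)$ and $v_{32}=(0,1)$. Write $u(\theta)=(\sin\theta,\cos\theta)$. The polygon $\mathsf B_{64}$. For $s\in(0,\pi/64)$ let $v_0-v_{31}-v_{62}-v_{30}-v_{61}-v_{28}-v_{60}-v_{27}-v_{58}-v_{26}-v_{57}-v_{24}-v_{56}-v_{23}-v_{54}-v_{22}-v_{53}-v_{20}-v_{52}-v_{19}-v_{50}-v_{18}-v_{49}-v_{16}$ be the path starting at the origin whose successive steps are alternately $+u(as)$ and $-u(as)$, with $a=1,3,4,5,7,8,9,11,12,13,15,16,17,19,20,21,23,24,25,27,28,29,31$ (that is, $1,\dots,31$ without the numbers congruent to $2$ modulo $4$). Let moreover $v_{63}=v_{31}-u(2s)$, $v_{29}=v_{61}+u(6s)$, $v_{59}=v_{27}-u(10s)$, $v_{25}=v_{57}+u(14s)$,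 $v_{55}=v_{23}-u(18s)$, $v_{21}=v_{53}+u(22s)$, $v_{51}=v_{19}-u(26s)$, $v_{17}=v_{49}+u(30s)$, and let symmetry give the other vertices. There is exactly one $s\in(0,\pi/64)$ with $\|v_{49}-v_{48}\|=2\sin(s/2)$, and $\mathsf B_{64}$ is the polygon for this $s$. The polygon $\mathsf Z_{64}$. For $t\in(0,\pi/64)$ and $y\in\mathbb R$ let $v_0-v_{31}-v_{63}-v_{30}-v_{61}-v_{29}-v_{60}-v_{28}-v_{58}-v_{27}-v_{57}-v_{26}-v_{56}-v_{25}-v_{55}-v_{24}-v_{54}-v_{23}-v_{53}-v_{21}-v_{52}-v_{19}-v_{51}-v_{16}$ be the path starting at the origin whose successive steps are alternately $+u(at)$ and $-u(at)$, with $a=1,2,3,5,6,7,8,10,11,12,13,14,15,16,17,18,19,20,22,23,25,26,29$. Let moreover $v_{62}=v_{30}-u(4t)$, $v_{59}=v_{28}-u(9t)$, $v_{22}=v_{53}+u(21t)$, $v_{20}=v_{52}+u(24t)$, $v_{18}=v_{51}+u(27t)$, $v_{17}=v_{51}+u(28t)$, $v_{50}=(-\tfrac12,y)$, $v_{15}=v_{50}+(\cos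 t,\sin t)$, and let symmetry give the other vertices. Proposition. There is exactly one pair $(t,y)$ with $t\in(0,\pi/64)$, $y\in\mathbb R$ and $\|v_{51}-v_{50}\|=\|v_{16}-v_{15}\|=2\sin(t/2)$, and it has $t=0.0490873533\ldots$. For this pair the polygon, called $\mathsf Z_{64}$, is a convex equilateral small $64$-gon. Its diameter graph consists exactly of the edge $v_0-v_{32}$, the edges of the path $v_0-\dots-v_{16}$ above, the edges $v_{30}-v_{62}$, $v_{28}-v_{59}$, $v_{53}-v_{22}$, $v_{52}-v_{20}$, $v_{51}-v_{18}$, $v_{51}-v_{17}$, the path $v_{15}-v_{50}-v_{14}-v_{49}$, and the mirror images of all these edges. Its perimeter is $$L(\mathsf Z_{64})=128\sin(t/2)=3.1412752155\ldots > L(\mathsf B_{64})=3.1412717079\ldots .$$ In particular there exists a convex equilateral small $64$-gon whose perimeter exceeds that of $\mathsf B_{64}$. -/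

import Mathlib

/-- The Euclidean plane. -/
abbrev Plane : Type := EuclideanSpace ℝ (Fin 2)

noncomputable section

/-! ### Polygons: perimeter, diameter, convexity -/

namespace Polygon

/-- The perimeter: the sum of the lengths of the sides (indices modulo `n`). -/
def perimeter {n : ℕ} [NeZero n] (P : Polygon Plane n) : ℝ :=
  ∑ i : Fin n, dist (P i) (P (i + 1))

/-- All sides have the same length. -/
def IsEquilateral {n : ℕ} [NeZero n] (P : Polygon Plane n) : Prop :=
  ∃ c : ℝ, ∀ i : Fin n, dist (P i) (P (i + 1)) = c

/-- A polygon is small if its diameter, the largest distance between two vertices, is one. -/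
def IsSmall {n : ℕ} (P : Polygon Plane n) : Prop :=
  IsGreatest {d : ℝ | ∃ i j : Fin n, d = dist (P i) (P j)} 1

/-- Twice the signed area of the triangle `a b c`: positive exactly when `c` lies strictly to the
left of the directed line from `a` to `b`. -/
def orient (a b c : Plane) : ℝ :=
  (b 0 - a 0) * (c 1 - a 1) - (b 1 - a 1) * (c 0 - a 0)

/-- The vertices, in their counterclockwise cyclic order, are the vertices of a (nondegenerate)
convex polygon: every vertex not on a side lies strictly to the left of that side. In particular
the vertices are distinct when `3 ≤ n`, and no three of them are collinear. -/
def IsConvex {n : ℕ} [NeZero n] (P : Polygon Plane n) : Prop :=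
  ∀ i k : Fin n, k ≠ i → k ≠ i + 1 → 0 < orient (P i) (P (i + 1)) (P k)

/-- The diameter graph of a small polygon: two vertices are joined when they are at distance
one. -/
def diameterGraph {n : ℕ} (P : Polygon Plane n) : SimpleGraph (Fin n) where
  Adj i j := dist (P i) (P j) = 1
  symm := ⟨fun i j h => by rw [dist_comm]; exact h⟩
  loopless := ⟨fun i h => by simp at h⟩

end Polygon

/-! ### Symmetric 64-gons built from a zigzag path of unit segments -/

/-- The unit vector at angle `θ` from the upward vertical. -/
def dir (θ : ℝ) : Plane := !₂[Real.sin θ, Real.cos θ]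

/-- Reflection in the vertical axis. -/
def mirror (p : Plane) : Plane := !₂[-p 0, p 1]

/-- The 64-gon, symmetric in the vertical axis, with given vertices `v₀, …, v₃₂`:
`v₆₄₋ᵢ` is the mirror image of `vᵢ`. -/
def symmetricPolygon (h : Fin 33 → Plane) : Polygon Plane 64 where
  vertices i :=
    if hi : i.val ≤ 32 then h ⟨i.val, by omega⟩
    else mirror (h ⟨64 - i.val, by omega⟩)

/-- The `j`-th vertex of the zigzag path of unit segments starting at the origin, whose `i`-th
segment goes alternately up and down and makes the angle `aᵢ t` with the vertical, where
`a` is a list of natural numbers. -/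
def zigzag (a : List ℕ) (t : ℝ) (j : ℕ) : Plane :=
  ∑ i ∈ Finset.range j, (-1 : ℝ) ^ i • dir ((a.getD i 0 : ℕ) * t)

/-! ### The 64-gon `B₆₄` -/

/-- The angles, in units of `t`, along the half-path
`v₀ - v₃₁ - v₆₂ - v₃₀ - v₆₁ - v₂₈ - v₆₀ - v₂₇ - v₅₈ - v₂₆ - v₅₇ - v₂₄ - v₅₆ - v₂₃ - v₅₄ - v₂₂ -
v₅₃ - v₂₀ - v₅₂ - v₁₉ - v₅₀ - v₁₈ - v₄₉ - v₁₆` of the diameter graph of `B₆₄`. -/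
def bAngles : List ℕ :=
  [1, 3, 4, 5, 7, 8, 9, 11, 12, 13, 15, 16, 17, 19, 20, 21, 23, 24, 25, 27, 28, 29, 31]

/-- The symmetric 64-gon with half-path as above, and with the pendant edges `v₃₁ - v₆₃`,
`v₆₁ - v₂₉`, `v₂₇ - v₅₉`, `v₅₇ - v₂₅`, `v₂₃ - v₅₅`, `v₅₃ - v₂₁`, `v₁₉ - v₅₁`, `v₄₉ - v₁₇`,
which make the angles `2t, 6t, 10t, …, 30t` with the vertical. -/
def polygonB (t : ℝ) : Polygon Plane 64 :=
  let p : ℕ → Plane := zigzag bAngles t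
  symmetricPolygon ![
    -- `v₀, …, v₇`
    p 0, mirror (p 1 - dir (2 * t)), mirror (p 2), mirror (p 4),
    mirror (p 6), mirror (p 7 - dir (10 * t)), mirror (p 8), mirror (p 10),
    -- `v₈, …, v₁₅`
    mirror (p 12), mirror (p 13 - dir (18 * t)), mirror (p 14), mirror (p 16),
    mirror (p 18), mirror (p 19 - dir (26 * t)), mirror (p 20), mirror (p 22),
    -- `v₁₆, …, v₂₃`
    p 23, p 22 + dir (30 * t), p 21, p 19, p 17, p 16 + dir (22 * t), p 15, p 13,
    -- `v₂₄, …, v₃₂`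
    p 11, p 10 + dir (14 * t), p 9, p 7, p 5, p 4 + dir (6 * t), p 3, p 1, !₂[0, 1]]

/-- The closing condition that determines the angle of `B₆₄`: the side `v₄₈ v₄₉` has the same
length `2 sin (t/2)` as the other sides. -/
def IsAngleB (t : ℝ) : Prop :=
  t ∈ Set.Ioo 0 (Real.pi / 64) ∧
    dist (polygonB t 49) (polygonB t 48) = 2 * Real.sin (t / 2)

/-! ### The 64-gon `Z₆₄` -/

/-- The angles, in units of `t`, along the half-path
`v₀ - v₃₁ - v₆₃ - v₃₀ - v₆₁ - v₂₉ - v₆₀ - v₂₈ - v₅₈ - v₂₇ - v₅₇ - v₂₆ - v₅₆ - v₂₅ - v₅₅ - v₂₄ -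
v₅₄ - v₂₃ - v₅₃ - v₂₁ - v₅₂ - v₁₉ - v₅₁ - v₁₆` of the diameter graph of `Z₆₄`. -/
def zAngles : List ℕ :=
  [1, 2, 3, 5, 6, 7, 8, 10, 11, 12, 13, 14, 15, 16, 17, 18, 19, 20, 22, 23, 25, 26, 29]

/-- The symmetric 64-gon with half-path as above, with the pendant edges `v₃₀ - v₆₂`,
`v₂₈ - v₅₉`, `v₅₃ - v₂₂`, `v₅₂ - v₂₀`, `v₅₁ - v₁₈`, `v₅₁ - v₁₇`, which make the angles
`4t, 9t, 21t, 24t, 27t, 28t` with the vertical, with `v₅₀ = (-1/2, y)`, and with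
`v₁₅ = v₅₀ + (cos t, sin t)`. -/
def polygonZ (t y : ℝ) : Polygon Plane 64 :=
  let p : ℕ → Plane := zigzag zAngles t
  symmetricPolygon ![
    -- `v₀, …, v₇`
    p 0, mirror (p 2), mirror (p 3 - dir (4 * t)), mirror (p 4),
    mirror (p 6), mirror (p 7 - dir (9 * t)), mirror (p 8), mirror (p 10),
    -- `v₈, …, v₁₃`
    mirror (p 12), mirror (p 14), mirror (p 16), mirror (p 18), mirror (p 20), mirror (p 22),
    -- `v₁₄, v₁₅`
    !₂[1 / 2, y], !₂[-1 / 2 + Real.cos t, y + Real.sin t],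
    -- `v₁₆, …, v₂₂`
    p 23, p 22 + dir (28 * t), p 22 + dir (27 * t), p 21, p 20 + dir (24 * t), p 19,
    p 18 + dir (21 * t),
    -- `v₂₃, …, v₃₂`
    p 17, p 15, p 13, p 11, p 9, p 7, p 5, p 3, p 1, !₂[0, 1]]

/-- The two-parameter system that determines `Z₆₄`: the sides `v₅₀ v₅₁` and `v₁₅ v₁₆` have the
same length `2 sin (t/2)` as the other sides. -/
def SystemZ (t y : ℝ) : Prop :=
  t ∈ Set.Ioo 0 (Real.pi / 64) ∧
    dist (polygonZ t y 51) (polygonZ t y 50) = 2 * Real.sin (t / 2) ∧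
    dist (polygonZ t y 16) (polygonZ t y 15) = 2 * Real.sin (t / 2)

/-- The consecutive pairs of a list: the edges of a path given by its vertices. -/
def pathEdges (l : List (Fin 64)) : List (Fin 64 × Fin 64) := l.zip l.tail

/-- One half of the edges of the prescribed diameter graph of `Z₆₄`: the axis `v₀ - v₃₂`, the
half-path, the pendant edges, and the path `v₁₅ - v₅₀ - v₁₄ - v₄₉`. -/
def zHalfEdges : List (Fin 64 × Fin 64) :=
  [(0, 32)] ++
  pathEdges [0, 31, 63, 30, 61, 29, 60, 28, 58, 27, 57, 26, 56, 25, 55, 24, 54, 23, 53, 21, 52,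
    19, 51, 16] ++
  [(30, 62), (28, 59), (53, 22), (52, 20), (51, 18), (51, 17)] ++
  pathEdges [15, 50, 14, 49]

/-- The prescribed diameter graph of `Z₆₄`: the edges above and their mirror images under
`i ↦ 64 - i` (negation modulo 64). -/
def graphZ : SimpleGraph (Fin 64) :=
  SimpleGraph.fromRel fun i j => (i, j) ∈ zHalfEdges ∨ (-i, -j) ∈ zHalfEdges

end

noncomputable section

/-! ### Tables of cosines and sines -/

/-! The path and pendant edges of the diameter graph are unit segments by construction. Two unit
segments from a common vertex at an angle `t` have endpoints at distance `2 sin (t/2)`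
(`dist_add_smul_dir`), which gives every side its length except, up to reflection, `v₄₈ v₄₉` in
`B₆₄` and `v₅₀ v₅₁`, `v₁₅ v₁₆` in `Z₆₄`. Only these closing sides impose equations.

For `Z₆₄`, let `w` be the rise from `v₅₁` to `v₅₀`. The system becomes `w² = V₁(t)`, `(g(t) - w)² =
V₂(t)`, where `g(t) = cos 29t - sin t` and each `Vᵢ` is the squared side length minus a squared
horizontal displacement (`systemZ_iff`). A side is shorter than `g(t)`, so `w` and `g - w` are
positive and `g = √V₁ + √V₂`. Near `π/64` the left side falls with slope below `-29` while the right
side increases. This gives uniqueness, and the intermediate value theorem gives a root within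
`10⁻¹⁵` of a known decimal. For `B₆₄` the single closing equation has a defect of slope below
`-5/2`, and the argument is the same.

The numerical input is a table of `cos (a t₀)`, `sin (a t₀)` in units of `10⁻²⁰`. It is certified by
checking in integers that consecutive entries are powers of one unit complex number, whose first
power is compared with a Taylor polynomial. Lipschitz bounds carry the table to nearby angles.

Convexity and the diameter graph are open conditions except at the prescribed edges, where the
distance is exactly one. Rounding the vertices to eight decimals leaves margins far above the
rounding error, so finite integer checks (`le_intOrient_vertexApprox`, `intDistSq_vertexApprox_le`)
decide everything else. The perimeters are `64` times the side length, evaluated at the two enclosed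
angles. -/

/-- The cosine entry of a table in units of `10⁻²⁰`. -/
def tableCos (T : List (ℤ × ℤ)) (a : ℕ) : ℤ := (T.getD a (0, 0)).1

/-- The sine entry of a table in units of `10⁻²⁰`. -/
def tableSin (T : List (ℤ × ℤ)) (a : ℕ) : ℤ := (T.getD a (0, 0)).2

/-- The table `T` gives `cos (a t)` and `sin (a t)` up to `a κ`, for all `a ≤ 31`. -/
def ApproxTable (T : List (ℤ × ℤ)) (t κ : ℝ) : Prop :=
  ∀ a : ℕ, a ≤ 31 → |Real.cos (a * t) - tableCos T a / 10 ^ 20| ≤ a * κ ∧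
    |Real.sin (a * t) - tableSin T a / 10 ^ 20| ≤ a * κ

/-- The integer conditions which make a table, up to rounding, the powers of its entry at `1`. -/
def IsPowerTable (T : List (ℤ × ℤ)) : Prop :=
  tableCos T 0 = 10 ^ 20 ∧ tableSin T 0 = 0 ∧
  tableCos T 1 ^ 2 + tableSin T 1 ^ 2 ≤ (10 ^ 20) ^ 2 ∧
  ∀ a < 31,
    |tableCos T 1 * tableCos T a - tableSin T 1 * tableSin T a - 10 ^ 20 * tableCos T (a + 1)|
      ≤ 2 * 10 ^ 20 ∧
    |tableCos T 1 * tableSin T a + tableSin T 1 * tableCos T a - 10 ^ 20 * tableSin T (a + 1)|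
      ≤ 2 * 10 ^ 20

instance (T : List (ℤ × ℤ)) : Decidable (IsPowerTable T) := by
  unfold IsPowerTable; infer_instance

/-- A table entry as a complex number. -/
def tableExp (T : List (ℤ × ℤ)) (a : ℕ) : ℂ :=
  ⟨tableCos T a / 10 ^ 20, tableSin T a / 10 ^ 20⟩

/-- Multiplication by the entry at `1`, of modulus at most one, does not enlarge the error already
present. Each step adds only the base error `ε` and a rounding error of at most `4 / 10 ^ 20`, so
the error grows linearly in `a`, not exponentially. -/
theorem IsPowerTable.norm_exp_sub_le {T : List (ℤ × ℤ)} (hT : IsPowerTable T) {t ε : ℝ}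
    (h : ‖Complex.exp (t * Complex.I) - tableExp T 1‖ ≤ ε) (a : ℕ) (ha : a ≤ 31) :
    ‖Complex.exp ((a * t : ℝ) * Complex.I) - tableExp T a‖ ≤ a * (ε + 4 / 10 ^ 20) := by
  obtain ⟨h0, h0', h1, hstep⟩ := hT
  have hz : ‖tableExp T 1‖ ≤ 1 := by
    rw [Complex.norm_def, Real.sqrt_le_one, Complex.normSq_apply]
    have : ((tableCos T 1 ^ 2 + tableSin T 1 ^ 2 : ℤ) : ℝ) ≤ ((10 ^ 20) ^ 2 : ℤ) := by
      exact_mod_cast h1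
    push_cast at this
    simp only [tableExp]
    rw [← mul_div_mul_comm, ← mul_div_mul_comm, ← add_div, div_le_one (by positivity)]
    linarith
  induction a with
  | zero =>
    have : tableExp T 0 = 1 := by norm_num [tableExp, h0, h0', Complex.ext_iff]
    simp [this]
  | succ a ih =>
    have ih := ih (by omega)
    obtain ⟨hc, hs⟩ := hstep a (by omega)
    have hround : ‖tableExp T 1 * tableExp T a - tableExp T (a + 1)‖ ≤ 4 / 10 ^ 20 := by
      refine (Complex.norm_le_abs_re_add_abs_im _).trans ?_
      have hc' : |((tableCos T 1 * tableCos T a - tableSin T 1 * tableSin T a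
          - 10 ^ 20 * tableCos T (a + 1) : ℤ) : ℝ)| ≤ (2 * 10 ^ 20 : ℤ) := by exact_mod_cast hc
      have hs' : |((tableCos T 1 * tableSin T a + tableSin T 1 * tableCos T a
          - 10 ^ 20 * tableSin T (a + 1) : ℤ) : ℝ)| ≤ (2 * 10 ^ 20 : ℤ) := by exact_mod_cast hs
      push_cast at hc' hs'
      rw [abs_le] at hc' hs'
      have e1 : |(tableExp T 1 * tableExp T a - tableExp T (a + 1)).re| ≤ 2 / 10 ^ 20 := by
        simp only [tableExp, Complex.sub_re, Complex.mul_re]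
        rw [abs_le]; constructor <;> linarith [hc'.1, hc'.2]
      have e2 : |(tableExp T 1 * tableExp T a - tableExp T (a + 1)).im| ≤ 2 / 10 ^ 20 := by
        simp only [tableExp, Complex.sub_im, Complex.mul_im]
        rw [abs_le]; constructor <;> linarith [hs'.1, hs'.2]
      linarith
    have hE : Complex.exp (((a + 1 : ℕ) * t : ℝ) * Complex.I)
        = Complex.exp (t * Complex.I) * Complex.exp ((a * t : ℝ) * Complex.I) := by
      rw [← Complex.exp_add]; congr 1; push_cast; ring
    have key : Complex.exp (((a + 1 : ℕ) * t : ℝ) * Complex.I) - tableExp T (a + 1)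
        = tableExp T 1 * (Complex.exp ((a * t : ℝ) * Complex.I) - tableExp T a)
          + (Complex.exp (t * Complex.I) - tableExp T 1) * Complex.exp ((a * t : ℝ) * Complex.I)
          + (tableExp T 1 * tableExp T a - tableExp T (a + 1)) := by
      rw [hE]; ring
    rw [key]
    refine (norm_add₃_le).trans ?_
    rw [norm_mul, norm_mul, Complex.norm_exp_ofReal_mul_I, mul_one]
    have : ‖tableExp T 1‖ * ‖Complex.exp ((a * t : ℝ) * Complex.I) - tableExp T a‖
        ≤ a * (ε + 4 / 10 ^ 20) := by
      refine le_trans ?_ ih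
      exact mul_le_of_le_one_left (norm_nonneg _) hz
    rw [Nat.cast_succ, add_one_mul]
    linarith

theorem IsPowerTable.approxTable {T : List (ℤ × ℤ)} (hT : IsPowerTable T) {t ε : ℝ}
    (h : ‖Complex.exp (t * Complex.I) - tableExp T 1‖ ≤ ε) :
    ApproxTable T t (ε + 4 / 10 ^ 20) := by
  intro a ha
  have key := hT.norm_exp_sub_le h a ha
  constructor
  · refine le_trans ?_ ((Complex.abs_re_le_norm _).trans key)
    rw [Complex.sub_re, Complex.exp_ofReal_mul_I_re]; rfl
  · refine le_trans ?_ ((Complex.abs_im_le_norm _).trans key)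
    rw [Complex.sub_im, Complex.exp_ofReal_mul_I_im]; rfl

/-- Cosine and sine of `a t` are `a`-Lipschitz in `t`, matching the shape `a κ` of the error. One
table therefore serves a whole interval of angles. -/
theorem ApproxTable.shift {T : List (ℤ × ℤ)} {t₀ κ t ρ : ℝ} (h : ApproxTable T t₀ κ)
    (ht : |t - t₀| ≤ ρ) : ApproxTable T t (κ + ρ) := by
  intro a ha
  have h1 : |a * t - a * t₀| ≤ a * ρ := by
    rw [← mul_sub, abs_mul, Nat.abs_cast]
    exact mul_le_mul_of_nonneg_left ht (Nat.cast_nonneg a)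
  obtain ⟨hc, hs⟩ := h a ha
  have hc' := (Real.abs_cos_sub_cos_le (a * t) (a * t₀)).trans h1
  have hs' := (Real.abs_sin_sub_sin_le (a * t) (a * t₀)).trans h1
  rw [mul_add]
  constructor
  · exact (abs_sub_le _ (Real.cos (a * t₀)) _).trans (by linarith)
  · exact (abs_sub_le _ (Real.sin (a * t₀)) _).trans (by linarith)

/-- The Taylor polynomial of order eleven of `exp (x I)`. -/
theorem norm_exp_mul_I_sub_taylor_le {x : ℝ} (hx : |x| ≤ 1 / 20) :
    ‖Complex.exp (x * Complex.I) -
      ⟨1 - x ^ 2 / 2 + x ^ 4 / 24 - x ^ 6 / 720 + x ^ 8 / 40320 - x ^ 10 / 3628800,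
        x - x ^ 3 / 6 + x ^ 5 / 120 - x ^ 7 / 5040 + x ^ 9 / 362880 - x ^ 11 / 39916800⟩‖
      ≤ 1 / 10 ^ 23 := by
  have hn : ‖(x * Complex.I : ℂ)‖ = |x| := by simp
  -- With twelve terms the remainder is at most `20⁻¹² · 13 / (12! · 12) < 10⁻²⁴`, well below one
  -- table unit.
  have h := Complex.exp_bound (x := x * Complex.I) (by rw [hn]; linarith) (n := 12) (by norm_num)
  have hpoly : ∑ m ∈ Finset.range 12, (x * Complex.I : ℂ) ^ m / (m.factorial : ℂ)
      = ⟨1 - x ^ 2 / 2 + x ^ 4 / 24 - x ^ 6 / 720 + x ^ 8 / 40320 - x ^ 10 / 3628800,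
        x - x ^ 3 / 6 + x ^ 5 / 120 - x ^ 7 / 5040 + x ^ 9 / 362880 - x ^ 11 / 39916800⟩ := by
    rw [Complex.mk_eq_add_mul_I]
    have I3 : Complex.I ^ 3 = -Complex.I := by rw [pow_succ, Complex.I_sq]; ring
    have I4 : Complex.I ^ 4 = 1 := Complex.I_pow_four
    have I5 : Complex.I ^ 5 = Complex.I := by rw [pow_succ, I4]; ring
    have I6 : Complex.I ^ 6 = -1 := by rw [pow_succ, I5, ← sq, Complex.I_sq]
    have I7 : Complex.I ^ 7 = -Complex.I := by rw [pow_succ, I6]; ring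
    have I8 : Complex.I ^ 8 = 1 := by rw [show 8 = 4 * 2 by norm_num, pow_mul, I4]; ring
    have I9 : Complex.I ^ 9 = Complex.I := by rw [pow_succ, I8]; ring
    have I10 : Complex.I ^ 10 = -1 := by rw [pow_succ, I9, ← sq, Complex.I_sq]
    have I11 : Complex.I ^ 11 = -Complex.I := by rw [pow_succ, I10]; ring
    simp only [Finset.sum_range_succ, Finset.sum_range_zero, mul_pow, Complex.I_sq, I3, I4, I5, I6,
      I7, I8, I9, I10, I11, Nat.factorial]
    push_cast
    ring
  rw [hpoly, hn] at h
  refine h.trans ?_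
  have hp : |x| ^ 12 ≤ (1 / 20) ^ 12 := pow_le_pow_left₀ (abs_nonneg x) hx 12
  refine (mul_le_mul_of_nonneg_right hp (by positivity)).trans ?_
  norm_num [Nat.factorial]

/-- An approximation of the angle of `Z₆₄`. -/
def centerZ : ℝ := 0.0490873533992997826

/-- An approximation of the angle of `B₆₄`. -/
def centerB : ℝ := 0.0490872985764496061

/-- Cosines and sines of the multiples `a * centerZ`, `a ≤ 31`, in units of `10⁻²⁰`. -/
def tableZ : List (ℤ × ℤ) :=
  [
    (100000000000000000000, 0), (99879545776616380952, 4906764255269745348),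
    (99518473290864142826, 9801707700985590316), (98917652396860415194, 14673038004922326136),
    (98078530522888795472, 19509019720907837039), (97003129184422352829, 24298002560504194704),
    (95694039114122100861, 29028449459536577971), (94154414020543184051, 33688964371855378947),
    (92387962990584582003, 38268319723373974900), (90398941553985471865, 42755483460243069984),
    (88192141431394631959, 47139645626000270103), (85772878990710653383, 51410244403668292681),
    (83146982439502611085, 55556991560064197028), (80320777784365734832, 59569897231022145157),
    (77301073591037178251, 63439293987819997863), (74095144581986054325, 67155860126831691551),
    (70710714110992528423, 70710642126298656040), (67155935556936188170, 74095076216120014097),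
    (63439372681617625580, 77301009008698116174), (59569978998932898406, 80320717141137960826),
    (55557076205102272059, 83146925881480783250), (51410331721916643001, 85772826654147823628),
    (47139735407101859868, 88192093442374000887), (42755575487907641863, 90398898028116643698),
    (38268413775899111577, 92387924032725051276), (33689060222660602970, 94154379724545725054),
    (29028546877709203261, 95694009562608668375), (24298101311355614720, 97003104448585038861),
    (19509119566538909456, 98078510662318321490), (14673138704796491972, 98917637459402573046),
    (9801809012508346822, 99518463312504530185), (4906865934373076655, 99879540781393708975)]

/-- Cosines and sines of the multiples `a * centerB`, `a ≤ 31`, in units of `10⁻²⁰`. -/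
def tableB : List (ℤ × ℤ) :=
  [
    (100000000000000000000, 0), (99879546045619032474, 4906758779588364166),
    (99518474365578650141, 9801696789212829359), (98917654810112369871, 14673021736079216191),
    (98078534801046698235, 19508998213129030407), (97003135844847478302, 24297975970563192198),
    (95694048662650937290, 29028417982215192712), (94154426949011575428, 33688928239159565102),
    (92387979774402565973, 38268279203598669193), (90398962649771643775, 42755438856889205238),
    (88192167274678673961, 47139597276547621709), (85772909993712448105, 51410192678208309215),
    (83147018988996112793, 55556936859797443634), (80320820239635497913, 59569839986625451363),
    (77301122281935144086, 63439234657688848747), (74095199807095874096, 67155799195203831198),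
    (70710776135908352101, 70710580101265283691), (67156004612662479870, 74095013627531345012),
    (63439448963096173817, 77300946405970449778), (59570062663702777682, 80320655090969746941),
    (55557167372098080922, 83146864965485502164), (51410430470409894569, 85772767466411796235),
    (47139841775789935089, 88192036586947520264), (42755689474154235049, 90398844116447068382),
    (38268535335129603256, 92387873681040722305), (33689189267915288562, 94154333551199762838),
    (29028683279356788890, 95693968185391871044), (24298244896968865269, 97003068482017240246),
    (19509270120933800354, 98078480714927673979), (14673295970235676784, 98917614131002297687),
    (9801972689069209157, 99518447191476723406), (4907035680480088888, 99879532441989811864)]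

theorem isPowerTable_tableZ : IsPowerTable tableZ := by decide +kernel

theorem isPowerTable_tableB : IsPowerTable tableB := by decide +kernel

theorem norm_exp_sub_tableExp_le {T : List (ℤ × ℤ)} {x : ℝ} (hx : |x| ≤ 1 / 20)
    (hc : |1 - x ^ 2 / 2 + x ^ 4 / 24 - x ^ 6 / 720 + x ^ 8 / 40320 - x ^ 10 / 3628800
      - tableCos T 1 / 10 ^ 20| ≤ 1 / 10 ^ 20)
    (hs : |x - x ^ 3 / 6 + x ^ 5 / 120 - x ^ 7 / 5040 + x ^ 9 / 362880 - x ^ 11 / 39916800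
      - tableSin T 1 / 10 ^ 20| ≤ 1 / 10 ^ 20) :
    ‖Complex.exp (x * Complex.I) - tableExp T 1‖ ≤ 3 / 10 ^ 20 := by
  have h := norm_exp_mul_I_sub_taylor_le hx
  set P : ℂ := ⟨1 - x ^ 2 / 2 + x ^ 4 / 24 - x ^ 6 / 720 + x ^ 8 / 40320 - x ^ 10 / 3628800,
        x - x ^ 3 / 6 + x ^ 5 / 120 - x ^ 7 / 5040 + x ^ 9 / 362880 - x ^ 11 / 39916800⟩ with hP
  have h2 : ‖P - tableExp T 1‖ ≤ 2 / 10 ^ 20 := by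
    refine (Complex.norm_le_abs_re_add_abs_im _).trans ?_
    simp only [Complex.sub_re, Complex.sub_im, hP, tableExp]
    linarith
  refine (norm_sub_le_norm_sub_add_norm_sub _ P _).trans ?_
  norm_num at h h2 ⊢
  linarith

theorem approxTable_tableZ : ApproxTable tableZ centerZ (7 / 10 ^ 20) := by
  have h := isPowerTable_tableZ.approxTable (t := centerZ) (ε := 3 / 10 ^ 20)
    (norm_exp_sub_tableExp_le (by norm_num [centerZ, abs_le])
      (by norm_num [centerZ, tableCos, tableZ, abs_le])
      (by norm_num [centerZ, tableSin, tableZ, abs_le]))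
  norm_num at h ⊢; exact h

theorem approxTable_tableB : ApproxTable tableB centerB (7 / 10 ^ 20) := by
  have h := isPowerTable_tableB.approxTable (t := centerB) (ε := 3 / 10 ^ 20)
    (norm_exp_sub_tableExp_le (by norm_num [centerB, abs_le])
      (by norm_num [centerB, tableCos, tableB, abs_le])
      (by norm_num [centerB, tableSin, tableB, abs_le]))
  norm_num at h ⊢; exact h

/-! ### Sums along a zigzag path -/

/-- The alternating sum of the values of `f` at the first `j` entries of a list. -/
def altSum {R : Type*} [Ring R] (f : ℕ → R) (l : List ℕ) (j : ℕ) : R :=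
  ∑ i ∈ Finset.range j, (-1 : R) ^ i * f (l.getD i 0)

theorem zigzag_apply_zero (l : List ℕ) (t : ℝ) (j : ℕ) :
    zigzag l t j 0 = altSum (fun a => Real.sin (a * t)) l j := by
  simp [zigzag, altSum, dir]

theorem zigzag_apply_one (l : List ℕ) (t : ℝ) (j : ℕ) :
    zigzag l t j 1 = altSum (fun a => Real.cos (a * t)) l j := by
  simp [zigzag, altSum, dir]

/-- The triangle inequality along the path. The weight `e` is `a` for plain sines and cosines and
`a²` for the terms `a cos (a t)` of a derivative. -/
theorem abs_altSum_sub_le {f : ℕ → ℝ} {g : ℕ → ℤ} {e : ℕ → ℕ} {κ N : ℝ} {l : List ℕ}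
    (hl : ∀ a ∈ l, a ≤ 31) (h : ∀ a ≤ 31, |f a - g a / N| ≤ e a * κ) (j : ℕ) :
    |altSum f l j - (altSum g l j : ℤ) / N|
      ≤ (∑ i ∈ Finset.range j, e (l.getD i 0) : ℕ) * κ := by
  have : altSum f l j - (altSum g l j : ℤ) / N
      = ∑ i ∈ Finset.range j, (-1 : ℝ) ^ i * (f (l.getD i 0) - g (l.getD i 0) / N) := by
    simp only [altSum]
    push_cast
    rw [Finset.sum_div, ← Finset.sum_sub_distrib]
    exact Finset.sum_congr rfl fun i _ => by ring
  rw [this]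
  push_cast
  rw [Finset.sum_mul]
  refine (Finset.abs_sum_le_sum_abs _ _).trans (Finset.sum_le_sum fun i _ => ?_)
  rw [abs_mul, abs_pow, abs_neg, abs_one, one_pow, one_mul]
  apply h
  rcases lt_or_ge i l.length with hi | hi
  · rw [List.getD_eq_getElem _ _ hi]; exact hl _ (List.getElem_mem hi)
  -- Past the end of the list the default entry is `0`, which the table also covers.
  · rw [List.getD_eq_default _ _ hi]; omega

theorem hasDerivAt_altSum_sin (l : List ℕ) (j : ℕ) (t : ℝ) :
    HasDerivAt (fun t : ℝ => altSum (fun a => Real.sin (a * t)) l j)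
      (altSum (fun a => a * Real.cos (a * t)) l j) t := by
  unfold altSum
  refine HasDerivAt.fun_sum fun i _ => ?_
  have h := ((hasDerivAt_id t).const_mul ((l.getD i 0 : ℕ) : ℝ)).sin
  simp only [id, mul_one] at h
  rw [mul_comm (Real.cos _)] at h
  exact h.const_mul _

/-! ### Plane geometry -/

theorem plane_dist_sq (p q : Plane) : dist p q ^ 2 = (p 0 - q 0) ^ 2 + (p 1 - q 1) ^ 2 := by
  rw [EuclideanSpace.dist_eq, Real.sq_sqrt (by positivity)]
  simp [Fin.sum_univ_two, Real.dist_eq, sq_abs]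

theorem plane_ext {p q : Plane} (h0 : p 0 = q 0) (h1 : p 1 = q 1) : p = q := by
  ext i; fin_cases i <;> assumption

@[simp] theorem mirror_apply_zero (p : Plane) : mirror p 0 = -p 0 := rfl

@[simp] theorem mirror_apply_one (p : Plane) : mirror p 1 = p 1 := rfl

@[simp] theorem dir_apply_zero (θ : ℝ) : dir θ 0 = Real.sin θ := rfl

@[simp] theorem dir_apply_one (θ : ℝ) : dir θ 1 = Real.cos θ := rfl

@[simp] theorem mirror_mirror (p : Plane) : mirror (mirror p) = p :=
  plane_ext (by simp) (by simp)

@[simp] theorem dist_mirror_mirror (p q : Plane) : dist (mirror p) (mirror q) = dist p q := by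
  rw [← sq_eq_sq₀ dist_nonneg dist_nonneg, plane_dist_sq, plane_dist_sq]
  simp only [mirror_apply_zero, mirror_apply_one]
  ring

theorem two_sin_half_sq (t : ℝ) : (2 * Real.sin (t / 2)) ^ 2 = 2 - 2 * Real.cos t := by
  have h := Real.cos_sq' (t / 2)
  have h2 := Real.cos_two_mul (t / 2)
  rw [mul_div_cancel₀ t two_ne_zero] at h2
  rw [h2, h]; ring

theorem two_sin_half_nonneg {t : ℝ} (h0 : 0 ≤ t) (h1 : t ≤ Real.pi) :
    0 ≤ 2 * Real.sin (t / 2) :=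
  mul_nonneg zero_le_two (Real.sin_nonneg_of_nonneg_of_le_pi (by linarith) (by linarith))

theorem dist_eq_two_sin_half_iff {p q : Plane} {t : ℝ} (h0 : 0 ≤ t) (h1 : t ≤ Real.pi) :
    dist p q = 2 * Real.sin (t / 2) ↔
      (p 0 - q 0) ^ 2 + (p 1 - q 1) ^ 2 = 2 - 2 * Real.cos t := by
  rw [← plane_dist_sq, ← two_sin_half_sq, sq_eq_sq₀ dist_nonneg (two_sin_half_nonneg h0 h1)]

theorem zigzag_succ (l : List ℕ) (t : ℝ) (j : ℕ) :
    zigzag l t (j + 1) = zigzag l t j + (-1 : ℝ) ^ j • dir ((l.getD j 0 : ℕ) * t) :=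
  Finset.sum_range_succ _ _

/-! ### The system that determines `Z₆₄` -/

theorem pi_div_64_gt : 0.0490873852123405 < Real.pi / 64 := by
  have := Real.pi_gt_d20; linarith

theorem pi_div_64_lt : Real.pi / 64 < 0.0490873852123406 := by
  have := Real.pi_lt_d20; linarith

theorem two_sin_half_le {t : ℝ} (h0 : 0 ≤ t) : 2 * Real.sin (t / 2) ≤ t := by
  have := Real.sin_le (x := t / 2) (by linarith)
  linarith

/-- The horizontal displacement from `v₅₀` to `v₅₁`. -/
def horizZ₁ (t : ℝ) : ℝ := altSum (fun a => Real.sin (a * t)) zAngles 22 + 1 / 2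

/-- The horizontal displacement from `v₁₅` to `v₁₆`. -/
def horizZ₂ (t : ℝ) : ℝ := altSum (fun a => Real.sin (a * t)) zAngles 23 + 1 / 2 - Real.cos t

/-- The square of the vertical displacement between `v₅₀` and `v₅₁`. -/
def vertSqZ₁ (t : ℝ) : ℝ := 2 - 2 * Real.cos t - horizZ₁ t ^ 2

/-- The square of the vertical displacement between `v₁₅` and `v₁₆`. -/
def vertSqZ₂ (t : ℝ) : ℝ := 2 - 2 * Real.cos t - horizZ₂ t ^ 2

/-- The sum of the vertical displacements from `v₅₁` to `v₅₀` and from `v₁₅` to `v₁₆`. -/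
def gapZ (t : ℝ) : ℝ := Real.cos (29 * t) - Real.sin t

/-- The vertical displacement from `v₅₁` to `v₅₀`. -/
def riseZ (t y : ℝ) : ℝ := y - altSum (fun a => Real.cos (a * t)) zAngles 22

/-- Here `v₅₁` and `v₁₆` are the last two path vertices, at heights differing by `cos 29t`, and
`v₁₅` lies `sin t` above `v₅₀`. So the two rises add up to `gapZ t`, and `y` enters only through
`riseZ`. -/
theorem systemZ_iff (t y : ℝ) : SystemZ t y ↔ t ∈ Set.Ioo 0 (Real.pi / 64) ∧
    riseZ t y ^ 2 = vertSqZ₁ t ∧ (gapZ t - riseZ t y) ^ 2 = vertSqZ₂ t := by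
  refine and_congr_right fun ht => ?_
  have h0 := ht.1.le
  have h1 : t ≤ Real.pi := ht.2.le.trans (by linarith [Real.pi_pos])
  have e51 : polygonZ t y 51 = zigzag zAngles t 22 := mirror_mirror _
  have e50 : polygonZ t y 50 = mirror !₂[1 / 2, y] := rfl
  have e16 : polygonZ t y 16 = zigzag zAngles t 23 := rfl
  have e15 : polygonZ t y 15 = !₂[-1 / 2 + Real.cos t, y + Real.sin t] := rfl
  have hs : altSum (fun a => Real.cos (a * t)) zAngles 23
      = altSum (fun a => Real.cos (a * t)) zAngles 22 + Real.cos (29 * t) := by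
    rw [altSum, Finset.sum_range_succ]; norm_num [altSum, zAngles]
  rw [dist_eq_two_sin_half_iff h0 h1, dist_eq_two_sin_half_iff h0 h1, e51, e50, e16, e15]
  simp only [zigzag_apply_zero, zigzag_apply_one, mirror_apply_zero, mirror_apply_one, hs,
    Matrix.cons_val_zero, Matrix.cons_val_one, riseZ, gapZ, vertSqZ₁, vertSqZ₂,
    horizZ₁, horizZ₂]
  constructor <;> rintro ⟨ha, hb⟩ <;> constructor <;> linarith

theorem zAngles_le : ∀ a ∈ zAngles, a ≤ 31 := by decide

theorem bAngles_le : ∀ a ∈ bAngles, a ≤ 31 := by decide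

/-! ### Alternating sums evaluated from a table -/

section Approx

variable {T : List (ℤ × ℤ)} {t κ : ℝ} {l : List ℕ}

theorem ApproxTable.altSum_sin (h : ApproxTable T t κ) (hl : ∀ a ∈ l, a ≤ 31) (j : ℕ) :
    |altSum (fun a => Real.sin (a * t)) l j - (altSum (tableSin T) l j : ℤ) / 10 ^ 20|
      ≤ (∑ i ∈ Finset.range j, l.getD i 0 : ℕ) * κ :=
  abs_altSum_sub_le (e := fun a => a) hl (fun a ha => (h a ha).2) j

theorem ApproxTable.altSum_cos (h : ApproxTable T t κ) (hl : ∀ a ∈ l, a ≤ 31) (j : ℕ) :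
    |altSum (fun a => Real.cos (a * t)) l j - (altSum (tableCos T) l j : ℤ) / 10 ^ 20|
      ≤ (∑ i ∈ Finset.range j, l.getD i 0 : ℕ) * κ :=
  abs_altSum_sub_le (e := fun a => a) hl (fun a ha => (h a ha).1) j

theorem ApproxTable.altSum_mul_cos (h : ApproxTable T t κ) (hl : ∀ a ∈ l, a ≤ 31) (j : ℕ) :
    |altSum (fun a => a * Real.cos (a * t)) l j
        - (altSum (fun a => a * tableCos T a) l j : ℤ) / 10 ^ 20|
      ≤ (∑ i ∈ Finset.range j, l.getD i 0 ^ 2 : ℕ) * κ := by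
  refine abs_altSum_sub_le (e := fun a => a ^ 2) hl (fun a ha => ?_) j
  push_cast
  rw [mul_div_assoc, ← mul_sub, abs_mul, Nat.abs_cast, sq, mul_assoc]
  exact mul_le_mul_of_nonneg_left (h a ha).1 (Nat.cast_nonneg a)

end Approx

/-- The interval in which the solution of the system for `Z₆₄` is sought. -/
def rangeZ : Set ℝ := Set.Icc 0.04907 0.04908738521235

theorem approxTable_rangeZ {t : ℝ} (ht : t ∈ rangeZ) : ApproxTable tableZ t 0.0000174 := by
  -- The left end of the range is the farther one, about `1.7354 · 10⁻⁵` from `centerZ`.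
  have := approxTable_tableZ.shift (t := t) (ρ := 0.00001736) (by
    rw [centerZ, abs_le]; constructor <;> linarith [ht.1, ht.2])
  intro a ha
  obtain ⟨h1, h2⟩ := this a ha
  have : (a : ℝ) * (7 / 10 ^ 20 + 0.00001736) ≤ a * 0.0000174 :=
    mul_le_mul_of_nonneg_left (by norm_num) (Nat.cast_nonneg a)
  exact ⟨h1.trans this, h2.trans this⟩

theorem altSum_tableSin_zAngles_22 :
    altSum (tableSin tableZ) zAngles 22 = -49401250685630041890 := by decide +kernel

theorem altSum_tableSin_zAngles_23 :
    altSum (tableSin tableZ) zAngles 23 = 49516386773772531156 := by decide +kernel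

theorem altSum_tableCos_zAngles_22 :
    altSum (tableCos tableZ) zAngles 22 = 33815212499784098777 := by decide +kernel

theorem altSum_mul_tableCos_zAngles_22 :
    altSum (fun a => a * tableCos tableZ a) zAngles 22 = -465795257328132987723 := by
  decide +kernel

theorem altSum_mul_tableCos_zAngles_23 :
    altSum (fun a => a * tableCos tableZ a) zAngles 23 = -40274234889034720535 := by
  decide +kernel

section Values

variable {t κ : ℝ}

theorem ApproxTable.horizZ₁ (h : ApproxTable tableZ t κ) :
    |horizZ₁ t - 598749314369958110 / 10 ^ 20| ≤ 293 * κ := by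
  have := h.altSum_sin zAngles_le 22
  rw [altSum_tableSin_zAngles_22,
    show ∑ i ∈ Finset.range 22, zAngles.getD i 0 = 293 by decide] at this
  refine le_of_eq_of_le (congrArg _ ?_) this
  rw [_root_.horizZ₁]; push_cast; ring

theorem ApproxTable.horizZ₂ (h : ApproxTable tableZ t κ) :
    |horizZ₂ t + 363159002843849796 / 10 ^ 20| ≤ 323 * κ := by
  have h1 := h.altSum_sin zAngles_le 23
  rw [altSum_tableSin_zAngles_23,
    show ∑ i ∈ Finset.range 23, zAngles.getD i 0 = 322 by decide] at h1
  -- The term `cos t` adds one more `κ` to the path weight `322`.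
  have h2 := (h 1 (by norm_num)).1
  rw [show tableCos tableZ 1 = 99879545776616380952 by decide] at h2
  rw [abs_le] at *
  push_cast [one_mul] at h1 h2
  rw [_root_.horizZ₂]
  constructor <;> linarith [h1.1, h1.2, h2.1, h2.2]

theorem ApproxTable.altSum_cos_zAngles (h : ApproxTable tableZ t κ) :
    |altSum (fun a => Real.cos (a * t)) zAngles 22 - 33815212499784098777 / 10 ^ 20|
      ≤ 293 * κ := by
  have := h.altSum_cos zAngles_le 22
  rwa [altSum_tableCos_zAngles_22,
    show ∑ i ∈ Finset.range 22, zAngles.getD i 0 = 293 by decide] at this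

theorem ApproxTable.cos_one (h : ApproxTable tableZ t κ) :
    |Real.cos t - 99879545776616380952 / 10 ^ 20| ≤ κ := by
  have h2 := (h 1 (by norm_num)).1
  rw [show tableCos tableZ 1 = 99879545776616380952 by decide] at h2
  simpa using h2

theorem ApproxTable.sin_one (h : ApproxTable tableZ t κ) :
    |Real.sin t - 4906764255269745348 / 10 ^ 20| ≤ κ := by
  have h2 := (h 1 (by norm_num)).2
  rw [show tableSin tableZ 1 = 4906764255269745348 by decide] at h2
  simpa using h2

theorem ApproxTable.cos_29 (h : ApproxTable tableZ t κ) :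
    |Real.cos (29 * t) - 14673138704796491972 / 10 ^ 20| ≤ 29 * κ := by
  have h2 := (h 29 (by norm_num)).1
  rw [show tableCos tableZ 29 = 14673138704796491972 by decide] at h2
  simpa using h2

theorem ApproxTable.sin_29 (h : ApproxTable tableZ t κ) :
    |Real.sin (29 * t) - 98917637459402573046 / 10 ^ 20| ≤ 29 * κ := by
  have h2 := (h 29 (by norm_num)).2
  rw [show tableSin tableZ 29 = 98917637459402573046 by decide] at h2
  simpa using h2

theorem abs_sq_sub_sq_le {x x₀ e M : ℝ} (h : |x - x₀| ≤ e) (hx : |x| ≤ M) (hx₀ : |x₀| ≤ M) :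
    |x ^ 2 - x₀ ^ 2| ≤ 2 * M * e := by
  rw [sq_sub_sq, abs_mul]
  exact mul_le_mul ((abs_add_le _ _).trans (by linarith)) h (abs_nonneg _)
    (by linarith [abs_nonneg x])

end Values

/-! ### Monotonicity on the range -/

theorem hasDerivAt_horizZ₁ (t : ℝ) :
    HasDerivAt horizZ₁ (altSum (fun a => a * Real.cos (a * t)) zAngles 22) t :=
  (hasDerivAt_altSum_sin zAngles 22 t).add_const _

theorem hasDerivAt_horizZ₂ (t : ℝ) :
    HasDerivAt horizZ₂ (altSum (fun a => a * Real.cos (a * t)) zAngles 23 + Real.sin t) t := by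
  have := ((hasDerivAt_altSum_sin zAngles 23 t).add_const (1 / 2)).sub (Real.hasDerivAt_cos t)
  rwa [sub_neg_eq_add] at this

theorem hasDerivAt_two_sub_cos_sub_sq {f : ℝ → ℝ} {f' t : ℝ} (hf : HasDerivAt f f' t) :
    HasDerivAt (fun t => 2 - 2 * Real.cos t - f t ^ 2) (2 * Real.sin t - 2 * (f t * f')) t := by
  have := (((Real.hasDerivAt_cos t).const_mul 2).const_sub 2).sub (hf.pow 2)
  convert! this using 1
  simp; ring

theorem monotoneOn_vertSqZ₁ : MonotoneOn vertSqZ₁ rangeZ := by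
  have hd : ∀ t, HasDerivAt vertSqZ₁ _ t :=
    fun t => hasDerivAt_two_sub_cos_sub_sq (hasDerivAt_horizZ₁ t)
  refine monotoneOn_of_deriv_nonneg (convex_Icc _ _)
    (fun t _ => (hd t).continuousAt.continuousWithinAt)
    (fun t _ => (hd t).differentiableAt.differentiableWithinAt) fun t ht => ?_
  have h := approxTable_rangeZ (interior_subset ht)
  rw [(hd t).deriv]
  have h1 := abs_le.1 h.horizZ₁
  have h2 := abs_le.1 h.sin_one
  have h3 := abs_le.1 (h.altSum_mul_cos zAngles_le 22)
  rw [altSum_mul_tableCos_zAngles_22,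
    show ∑ i ∈ Finset.range 22, zAngles.getD i 0 ^ 2 = 5087 by decide] at h3
  norm_num at h1 h2 h3
  -- On the range the displacement is positive and its derivative, near `-4.66`, is negative, so
  -- both terms of the derivative of `vertSqZ₁` are positive.
  nlinarith [h1.1, h1.2, h2.1, h3.1, h3.2]

theorem monotoneOn_vertSqZ₂ : MonotoneOn vertSqZ₂ rangeZ := by
  have hd : ∀ t, HasDerivAt vertSqZ₂ _ t :=
    fun t => hasDerivAt_two_sub_cos_sub_sq (hasDerivAt_horizZ₂ t)
  refine monotoneOn_of_deriv_nonneg (convex_Icc _ _)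
    (fun t _ => (hd t).continuousAt.continuousWithinAt)
    (fun t _ => (hd t).differentiableAt.differentiableWithinAt) fun t ht => ?_
  have h := approxTable_rangeZ (interior_subset ht)
  rw [(hd t).deriv]
  have h1 := abs_le.1 h.horizZ₂
  have h2 := abs_le.1 h.sin_one
  have h3 := abs_le.1 (h.altSum_mul_cos zAngles_le 23)
  rw [altSum_mul_tableCos_zAngles_23,
    show ∑ i ∈ Finset.range 23, zAngles.getD i 0 ^ 2 = 5928 by decide] at h3
  norm_num at h1 h2 h3
  -- Here the displacement may change sign, but it stays below `0.01` and its derivative below `1/2`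
  -- in absolute value. Their product is dominated by `sin t`, about `0.049`.
  nlinarith [h1.1, h1.2, h2.1, h3.1, h3.2]

/-- The derivative `-29 sin 29t - cos t` is about `-29.7` on the range. The quantitative slope is
what later converts numerical errors into a root enclosure. -/
theorem gapZ_add_le {t t' : ℝ} (ht : t ∈ rangeZ) (ht' : t' ∈ rangeZ) (h : t ≤ t') :
    gapZ t' + 29 * (t' - t) ≤ gapZ t := by
  have hd : ∀ t, HasDerivAt (fun t => gapZ t + 29 * t)
      (-Real.sin (29 * t) * 29 - Real.cos t + 29) t := fun t => by
    have h1 := ((hasDerivAt_id t).const_mul (29 : ℝ)).cos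
    have h2 := (h1.sub (Real.hasDerivAt_sin t)).add ((hasDerivAt_id t).const_mul (29 : ℝ))
    simpa [gapZ] using! h2
  have hanti : AntitoneOn (fun t => gapZ t + 29 * t) rangeZ := by
    refine antitoneOn_of_deriv_nonpos (convex_Icc _ _)
      (fun t _ => (hd t).continuousAt.continuousWithinAt)
      (fun t _ => (hd t).differentiableAt.differentiableWithinAt) fun t ht => ?_
    have h := approxTable_rangeZ (interior_subset ht)
    rw [(hd t).deriv]
    have h1 := abs_le.1 h.cos_one
    have h2 := abs_le.1 h.sin_29
    norm_num at h1 h2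
    linarith [h1.1, h2.1]
  have := hanti ht ht' h
  simp only at this
  linarith

theorem centerZ_mem : centerZ ∈ rangeZ := by
  rw [centerZ, rangeZ]; constructor <;> norm_num

theorem gapZ_centerZ : |gapZ centerZ - 0.09766374449526746623830| ≤ 1 / 10 ^ 17 := by
  have h1 := abs_le.1 approxTable_tableZ.cos_29
  have h2 := abs_le.1 approxTable_tableZ.sin_one
  rw [gapZ, abs_le]
  norm_num at h1 h2 ⊢
  constructor <;> linarith [h1.1, h1.2, h2.1, h2.2]

theorem two_sin_half_le_of_mem {t : ℝ} (h0 : 0 ≤ t) (h : t < Real.pi / 64) :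
    2 * Real.sin (t / 2) ≤ 0.04908738521235 := by
  have := two_sin_half_le h0
  linarith [pi_div_64_lt]

/-- Solutions of the system lie in the range. -/
theorem mem_rangeZ_of_systemZ {t y : ℝ} (h : SystemZ t y) : t ∈ rangeZ := by
  obtain ⟨⟨h0, h1⟩, hA, hB⟩ := (systemZ_iff t y).1 h
  refine ⟨?_, by linarith [pi_div_64_lt]⟩
  by_contra! hlt
  -- Below `0.04907` the gap is at least its value there, about `0.09817`, by monotonicity of cosine
  -- and sine. The two rises are at most one side length each, in total at most `2t < 0.09814`.
  have hm : (0.04907 : ℝ) ∈ rangeZ := ⟨le_rfl, by norm_num⟩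
  have hc := abs_le.1 gapZ_centerZ
  have hg := gapZ_add_le hm centerZ_mem (by norm_num [centerZ])
  have hpi := Real.pi_gt_d6
  have hr := two_sin_half_nonneg h0.le (by linarith)
  have hcos : Real.cos (29 * 0.04907) ≤ Real.cos (29 * t) :=
    Real.cos_le_cos_of_nonneg_of_le_pi (by linarith) (by linarith) (by linarith)
  have hsin : Real.sin t ≤ Real.sin 0.04907 :=
    Real.sin_le_sin_of_le_of_le_pi_div_two (by linarith) (by linarith) hlt.le
  have hle := two_sin_half_le h0.le
  have hw : riseZ t y ≤ 2 * Real.sin (t / 2) := by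
    refine le_of_pow_le_pow_left₀ two_ne_zero hr ?_
    rw [hA, two_sin_half_sq, vertSqZ₁]; linarith [sq_nonneg (horizZ₁ t)]
  have hw' : gapZ t - riseZ t y ≤ 2 * Real.sin (t / 2) := by
    refine le_of_pow_le_pow_left₀ two_ne_zero hr ?_
    rw [hB, two_sin_half_sq, vertSqZ₂]; linarith [sq_nonneg (horizZ₂ t)]
  have hgt : gapZ 0.04907 ≤ gapZ t := by rw [gapZ, gapZ]; linarith
  norm_num [centerZ] at hc hg hgt hlt
  linarith [hc.1]

/-- For solutions of the system both vertical displacements are positive. -/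
theorem riseZ_pos_of_systemZ {t y : ℝ} (h : SystemZ t y) :
    0 < riseZ t y ∧ 0 < gapZ t - riseZ t y := by
  have hm := mem_rangeZ_of_systemZ h
  obtain ⟨⟨h0, h1⟩, hA, hB⟩ := (systemZ_iff t y).1 h
  have hr := two_sin_half_nonneg h0.le (by linarith [Real.pi_pos])
  have hle := two_sin_half_le_of_mem h0.le h1
  have hw : riseZ t y ≤ 2 * Real.sin (t / 2) := by
    refine le_of_pow_le_pow_left₀ two_ne_zero hr ?_
    rw [hA, two_sin_half_sq, vertSqZ₁]; linarith [sq_nonneg (horizZ₁ t)]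
  have hw' : gapZ t - riseZ t y ≤ 2 * Real.sin (t / 2) := by
    refine le_of_pow_le_pow_left₀ two_ne_zero hr ?_
    rw [hB, two_sin_half_sq, vertSqZ₂]; linarith [sq_nonneg (horizZ₂ t)]
  have hT := approxTable_rangeZ hm
  have h29 := abs_le.1 hT.cos_29
  have hs1 := abs_le.1 hT.sin_one
  -- The gap exceeds one side length, so neither rise can absorb all of it.
  have : 0.09 ≤ gapZ t := by
    rw [gapZ]; norm_num at h29 hs1 ⊢; linarith [h29.1, hs1.2]
  constructor <;> linarith

/-- Increasing `t` would weakly increase both positive rises, yet their sum, the gap, strictly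
decreases. -/
theorem systemZ_not_lt {t y t' y' : ℝ} (h : SystemZ t y) (h' : SystemZ t' y') : ¬ t < t' := by
  intro hlt
  have hm := mem_rangeZ_of_systemZ h
  have hm' := mem_rangeZ_of_systemZ h'
  obtain ⟨hp, hq⟩ := riseZ_pos_of_systemZ h
  obtain ⟨hp', hq'⟩ := riseZ_pos_of_systemZ h'
  obtain ⟨-, hA, hB⟩ := (systemZ_iff t y).1 h
  obtain ⟨-, hA', hB'⟩ := (systemZ_iff t' y').1 h'
  have h1 : riseZ t y ≤ riseZ t' y' := by
    refine le_of_pow_le_pow_left₀ two_ne_zero hp'.le ?_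
    rw [hA, hA']; exact monotoneOn_vertSqZ₁ hm hm' hlt.le
  have h2 : gapZ t - riseZ t y ≤ gapZ t' - riseZ t' y' := by
    refine le_of_pow_le_pow_left₀ two_ne_zero hq'.le ?_
    rw [hB, hB']; exact monotoneOn_vertSqZ₂ hm hm' hlt.le
  linarith [gapZ_add_le hm hm' hlt.le]

theorem systemZ_unique {t y t' y' : ℝ} (h : SystemZ t y) (h' : SystemZ t' y') :
    t' = t ∧ y' = y := by
  have ht : t' = t := le_antisymm (not_lt.1 (systemZ_not_lt h h')) (not_lt.1 (systemZ_not_lt h' h))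
  subst ht
  refine ⟨rfl, ?_⟩
  have := ((systemZ_iff _ _).1 h).2.1.trans ((systemZ_iff _ _).1 h').2.1.symm
  rw [sq_eq_sq₀ (riseZ_pos_of_systemZ h).1.le (riseZ_pos_of_systemZ h').1.le] at this
  simp only [riseZ] at this
  linarith

/-! ### Existence of the solution -/

theorem vertSqZ₁_centerZ : |vertSqZ₁ centerZ - 0.0023732343935265314569| ≤ 1 / 10 ^ 17 := by
  have h1 := approxTable_tableZ.horizZ₁
  have h2 := abs_le.1 approxTable_tableZ.cos_one
  have h1' := abs_le.1 h1
  norm_num at h1'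
  have h3 := abs_le.1 (abs_sq_sub_sq_le (M := 1 / 100) h1
    (by rw [abs_le]; constructor <;> linarith [h1'.1, h1'.2])
    (by norm_num [abs_le]))
  rw [vertSqZ₁, abs_le]
  norm_num at h2 h3 ⊢
  constructor <;> linarith [h2.1, h2.2, h3.1, h3.2]

theorem vertSqZ₂_centerZ : |vertSqZ₂ centerZ - 0.0023958960215377270189| ≤ 1 / 10 ^ 17 := by
  have h1 := approxTable_tableZ.horizZ₂
  have h2 := abs_le.1 approxTable_tableZ.cos_one
  have h1' := abs_le.1 h1
  norm_num at h1'
  rw [← sub_neg_eq_add] at h1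
  have h3 := abs_le.1 (abs_sq_sub_sq_le (M := 1 / 100) h1
    (by rw [abs_le]; constructor <;> linarith [h1'.1, h1'.2])
    (by norm_num [abs_le]))
  rw [vertSqZ₂, abs_le]
  norm_num at h2 h3 ⊢
  constructor <;> linarith [h2.1, h2.2, h3.1, h3.2]

theorem sqrt_vertSqZ₁_centerZ : |√(vertSqZ₁ centerZ) - 0.0487158536159075| ≤ 1 / 10 ^ 15 := by
  have h := abs_le.1 vertSqZ₁_centerZ
  norm_num at h
  rw [abs_le]
  constructor
  · rw [neg_le_sub_iff_le_add, ← sub_le_iff_le_add]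
    apply Real.le_sqrt_of_sq_le; norm_num; linarith [h.1]
  · rw [sub_le_iff_le_add]
    apply Real.sqrt_le_iff.2; norm_num; linarith [h.2]

theorem sqrt_vertSqZ₂_centerZ : |√(vertSqZ₂ centerZ) - 0.0489478908793600| ≤ 1 / 10 ^ 15 := by
  have h := abs_le.1 vertSqZ₂_centerZ
  norm_num at h
  rw [abs_le]
  constructor
  · rw [neg_le_sub_iff_le_add, ← sub_le_iff_le_add]
    apply Real.le_sqrt_of_sq_le; norm_num; linarith [h.1]
  · rw [sub_le_iff_le_add]
    apply Real.sqrt_le_iff.2; norm_num; linarith [h.2]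

/-- Moving `t` by `10⁻¹⁵` changes the gap by at least `2.9 · 10⁻¹⁴`, against a numerical error of
about `2 · 10⁻¹⁵` at the centre. The square roots move in the helpful direction by monotonicity. -/
theorem exists_systemZ : ∃ t y : ℝ, SystemZ t y ∧ |t - centerZ| ≤ 1 / 10 ^ 15 := by
  set g : ℝ → ℝ := fun t => gapZ t - √(vertSqZ₁ t) - √(vertSqZ₂ t) with hg
  have hcont : Continuous g := by
    have h1 : Continuous horizZ₁ :=
      continuous_iff_continuousAt.2 fun t => (hasDerivAt_horizZ₁ t).continuousAt
    have h2 : Continuous horizZ₂ :=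
      continuous_iff_continuousAt.2 fun t => (hasDerivAt_horizZ₂ t).continuousAt
    have h3 : Continuous vertSqZ₁ := by unfold vertSqZ₁; fun_prop
    have h4 : Continuous vertSqZ₂ := by unfold vertSqZ₂; fun_prop
    have h5 : Continuous gapZ := by unfold gapZ; fun_prop
    fun_prop
  have hc := abs_le.1 gapZ_centerZ
  have hA := abs_le.1 sqrt_vertSqZ₁_centerZ
  have hB := abs_le.1 sqrt_vertSqZ₂_centerZ
  have hmem : ∀ t, |t - centerZ| ≤ 1 / 10 ^ 15 → t ∈ rangeZ := fun t ht => by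
    rw [abs_le, centerZ] at ht
    norm_num at ht
    constructor <;> norm_num <;> linarith [ht.1, ht.2]
  have hl : |centerZ - 1 / 10 ^ 15 - centerZ| ≤ 1 / 10 ^ 15 := by norm_num [abs_le]
  have hu : |centerZ + 1 / 10 ^ 15 - centerZ| ≤ 1 / 10 ^ 15 := by norm_num [abs_le]
  have hlow : 0 ≤ g (centerZ - 1 / 10 ^ 15) := by
    have h1 := gapZ_add_le (hmem _ hl) centerZ_mem (by norm_num)
    have h2 := Real.sqrt_le_sqrt (monotoneOn_vertSqZ₁ (hmem _ hl) centerZ_mem (by norm_num))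
    have h3 := Real.sqrt_le_sqrt (monotoneOn_vertSqZ₂ (hmem _ hl) centerZ_mem (by norm_num))
    simp only [hg]
    norm_num at hc hA hB h1 h2 h3 ⊢
    linarith [hc.1, hA.2, hB.2]
  have hupp : g (centerZ + 1 / 10 ^ 15) ≤ 0 := by
    have h1 := gapZ_add_le centerZ_mem (hmem _ hu) (by norm_num)
    have h2 := Real.sqrt_le_sqrt (monotoneOn_vertSqZ₁ centerZ_mem (hmem _ hu) (by norm_num))
    have h3 := Real.sqrt_le_sqrt (monotoneOn_vertSqZ₂ centerZ_mem (hmem _ hu) (by norm_num))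
    simp only [hg]
    norm_num at hc hA hB h1 h2 h3 ⊢
    linarith [hc.2, hA.1, hB.1]
  obtain ⟨t, ⟨ht1, ht2⟩, ht⟩ := intermediate_value_Icc'
    (by linarith : centerZ - 1 / 10 ^ 15 ≤ centerZ + 1 / 10 ^ 15) hcont.continuousOn ⟨hupp, hlow⟩
  have htc : |t - centerZ| ≤ 1 / 10 ^ 15 := abs_le.2 ⟨by linarith, by linarith⟩
  have hT := approxTable_rangeZ (hmem t htc)
  have hc1 := abs_le.1 hT.cos_one
  have hh1 := abs_le.1 hT.horizZ₁
  have hh2 := abs_le.1 hT.horizZ₂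
  norm_num at hc1 hh1 hh2
  -- Real square roots vanish on negative numbers, so nonnegativity is needed to recover the squared
  -- equations.
  have hA0 : 0 ≤ vertSqZ₁ t := by
    rw [vertSqZ₁]; nlinarith [hc1.2, hh1.1, hh1.2]
  have hB0 : 0 ≤ vertSqZ₂ t := by
    rw [vertSqZ₂]; nlinarith [hc1.2, hh2.1, hh2.2]
  refine ⟨t, altSum (fun a => Real.cos (a * t)) zAngles 22 + √(vertSqZ₁ t),
    (systemZ_iff _ _).2 ⟨?_, ?_, ?_⟩, htc⟩
  · rw [abs_le, centerZ] at htc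
    norm_num at htc
    exact ⟨by linarith [htc.1], by linarith [htc.2, pi_div_64_gt]⟩
  · rw [riseZ, add_sub_cancel_left, Real.sq_sqrt hA0]
  · rw [riseZ, add_sub_cancel_left, ← Real.sq_sqrt hB0]
    simp only [hg] at ht
    congr 1; linarith

/-! ### The equation that determines `B₆₄` -/

/-- The horizontal displacement from `v₄₈` to `v₄₉`. -/
def horizB (s : ℝ) : ℝ :=
  altSum (fun a => Real.sin (a * s)) bAngles 22 + altSum (fun a => Real.sin (a * s)) bAngles 23

/-- The defect in the closing condition of `B₆₄`. -/
def defectB (s : ℝ) : ℝ := horizB s ^ 2 + Real.cos (31 * s) ^ 2 - (2 - 2 * Real.cos s)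

/-- Since `v₄₈` is the mirror image of the last path vertex and `v₄₉` is the vertex before it, the
horizontal difference is a sum of two abscissae and the vertical one is the last step, `cos 31s`. -/
theorem isAngleB_iff (s : ℝ) :
    IsAngleB s ↔ s ∈ Set.Ioo 0 (Real.pi / 64) ∧ defectB s = 0 := by
  refine and_congr_right fun hs => ?_
  have e49 : polygonB s 49 = zigzag bAngles s 22 := mirror_mirror _
  have e48 : polygonB s 48 = mirror (zigzag bAngles s 23) := rfl
  have hc : altSum (fun a => Real.cos (a * s)) bAngles 23
      = altSum (fun a => Real.cos (a * s)) bAngles 22 + Real.cos (31 * s) := by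
    rw [altSum, Finset.sum_range_succ]; norm_num [altSum, bAngles]
  rw [dist_eq_two_sin_half_iff hs.1.le (hs.2.le.trans (by linarith [Real.pi_pos])), e49, e48]
  simp only [zigzag_apply_zero, zigzag_apply_one, mirror_apply_zero, mirror_apply_one, hc,
    defectB, horizB]
  constructor <;> intro h <;> linarith

/-- The interval in which the angle of `B₆₄` is sought. -/
def rangeB : Set ℝ := Set.Icc 0.04908 0.04908738521235

theorem approxTable_rangeB {s : ℝ} (hs : s ∈ rangeB) : ApproxTable tableB s 0.0000074 := by
  have := approxTable_tableB.shift (t := s) (ρ := 0.0000073) (by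
    rw [centerB, abs_le]; constructor <;> linarith [hs.1, hs.2])
  intro a ha
  obtain ⟨h1, h2⟩ := this a ha
  have : (a : ℝ) * (7 / 10 ^ 20 + 0.0000073) ≤ a * 0.0000074 :=
    mul_le_mul_of_nonneg_left (by norm_num) (Nat.cast_nonneg a)
  exact ⟨h1.trans this, h2.trans this⟩

theorem altSum_tableSin_bAngles_22 :
    altSum (tableSin tableB) bAngles 22 = -49885471408423133145 := by decide +kernel

theorem altSum_tableSin_bAngles_23 :
    altSum (tableSin tableB) bAngles 23 = 49994061033566678719 := by decide +kernel

theorem altSum_mul_tableCos_bAngles_22 :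
    altSum (fun a => a * tableCos tableB a) bAngles 22 = -152667705395469174937 := by
  decide +kernel

theorem altSum_mul_tableCos_bAngles_23 :
    altSum (fun a => a * tableCos tableB a) bAngles 23 = -549599300586419409 := by
  decide +kernel

section Values

variable {s κ : ℝ}

theorem ApproxTable.horizB (h : ApproxTable tableB s κ) :
    |horizB s - 108589625143545574 / 10 ^ 20| ≤ 705 * κ := by
  have h1 := h.altSum_sin bAngles_le 22
  have h2 := h.altSum_sin bAngles_le 23
  rw [altSum_tableSin_bAngles_22,
    show ∑ i ∈ Finset.range 22, bAngles.getD i 0 = 337 by decide] at h1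
  rw [altSum_tableSin_bAngles_23,
    show ∑ i ∈ Finset.range 23, bAngles.getD i 0 = 368 by decide] at h2
  rw [abs_le] at *
  push_cast at h1 h2
  rw [_root_.horizB]
  constructor <;> linarith [h1.1, h1.2, h2.1, h2.2]

theorem ApproxTable.cos_oneB (h : ApproxTable tableB s κ) :
    |Real.cos s - 99879546045619032474 / 10 ^ 20| ≤ κ := by
  have h2 := (h 1 (by norm_num)).1
  rw [show tableCos tableB 1 = 99879546045619032474 by decide] at h2
  simpa using h2

theorem ApproxTable.cos_31 (h : ApproxTable tableB s κ) :
    |Real.cos (31 * s) - 4907035680480088888 / 10 ^ 20| ≤ 31 * κ := by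
  have h2 := (h 31 (by norm_num)).1
  rw [show tableCos tableB 31 = 4907035680480088888 by decide] at h2
  simpa using h2

theorem ApproxTable.sin_31 (h : ApproxTable tableB s κ) :
    |Real.sin (31 * s) - 99879532441989811864 / 10 ^ 20| ≤ 31 * κ := by
  have h2 := (h 31 (by norm_num)).2
  rw [show tableSin tableB 31 = 99879532441989811864 by decide] at h2
  simpa using h2

end Values

theorem hasDerivAt_horizB (s : ℝ) :
    HasDerivAt horizB (altSum (fun a => a * Real.cos (a * s)) bAngles 22
      + altSum (fun a => a * Real.cos (a * s)) bAngles 23) s :=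
  (hasDerivAt_altSum_sin bAngles 22 s).add (hasDerivAt_altSum_sin bAngles 23 s)

theorem hasDerivAt_cos_31 (s : ℝ) :
    HasDerivAt (fun s => Real.cos (31 * s)) (-Real.sin (31 * s) * 31) s := by
  simpa using ((hasDerivAt_id s).const_mul (31 : ℝ)).cos

theorem cos_31_add_le {s s' : ℝ} (hs : s ∈ rangeB) (hs' : s' ∈ rangeB) (h : s ≤ s') :
    Real.cos (31 * s') + 30 * (s' - s) ≤ Real.cos (31 * s) := by
  have hd : ∀ s, HasDerivAt (fun s => Real.cos (31 * s) + 30 * s)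
      (-Real.sin (31 * s) * 31 + 30) s := fun s => by
    simpa using! (hasDerivAt_cos_31 s).add ((hasDerivAt_id s).const_mul (30 : ℝ))
  have hanti : AntitoneOn (fun s => Real.cos (31 * s) + 30 * s) rangeB := by
    refine antitoneOn_of_deriv_nonpos (convex_Icc _ _)
      (fun s _ => (hd s).continuousAt.continuousWithinAt)
      (fun s _ => (hd s).differentiableAt.differentiableWithinAt) fun s hs => ?_
    rw [(hd s).deriv]
    have h2 := abs_le.1 (approxTable_rangeB (interior_subset hs)).sin_31
    norm_num at h2
    linarith [h2.1]
  have := hanti hs hs' h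
  simp only at this
  linarith

theorem hasDerivAt_defectB (s : ℝ) :
    HasDerivAt defectB (2 * horizB s * (altSum (fun a => a * Real.cos (a * s)) bAngles 22
      + altSum (fun a => a * Real.cos (a * s)) bAngles 23)
      - 62 * (Real.cos (31 * s) * Real.sin (31 * s)) - 2 * Real.sin s) s := by
  have := (((hasDerivAt_horizB s).pow 2).add ((hasDerivAt_cos_31 s).pow 2)).sub
    (((Real.hasDerivAt_cos s).const_mul 2).const_sub 2)
  convert! this using 1
  simp; ring

/-- The term `-62 cos 31s sin 31s`, about `-3`, dominates: the horizontal displacement is below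
`0.01` with derivative at most `2` in absolute value, and `-2 sin s` only helps. -/
theorem defectB_add_le {s s' : ℝ} (hs : s ∈ rangeB) (hs' : s' ∈ rangeB) (h : s ≤ s') :
    defectB s' + 5 / 2 * (s' - s) ≤ defectB s := by
  have hd : ∀ s, HasDerivAt (fun s => defectB s + 5 / 2 * s) _ s := fun s =>
    (hasDerivAt_defectB s).add ((hasDerivAt_id s).const_mul (5 / 2 : ℝ))
  have hanti : AntitoneOn (fun s => defectB s + 5 / 2 * s) rangeB := by
    refine antitoneOn_of_deriv_nonpos (convex_Icc _ _)
      (fun s _ => (hd s).continuousAt.continuousWithinAt)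
      (fun s _ => (hd s).differentiableAt.differentiableWithinAt) fun s hs => ?_
    rw [(hd s).deriv]
    have hs := interior_subset hs
    have h := approxTable_rangeB hs
    have h0 : 0 ≤ Real.sin s := Real.sin_nonneg_of_nonneg_of_le_pi
      (by linarith [hs.1]) (by linarith [hs.2, Real.pi_gt_three])
    have h1 := abs_le.1 h.horizB
    have h2 := abs_le.1 h.cos_31
    have h3 := abs_le.1 h.sin_31
    have h4 := abs_le.1 (h.altSum_mul_cos bAngles_le 22)
    have h5 := abs_le.1 (h.altSum_mul_cos bAngles_le 23)
    rw [altSum_mul_tableCos_bAngles_22,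
      show ∑ i ∈ Finset.range 22, bAngles.getD i 0 ^ 2 = 6735 by decide] at h4
    rw [altSum_mul_tableCos_bAngles_23,
      show ∑ i ∈ Finset.range 23, bAngles.getD i 0 ^ 2 = 7696 by decide] at h5
    norm_num at h1 h2 h3 h4 h5
    set u := altSum (fun a => a * Real.cos (a * s)) bAngles 22
      + altSum (fun a => a * Real.cos (a * s)) bAngles 23 with hu
    have hu1 : |u| ≤ 2 := by
      rw [abs_le]; constructor <;> linarith [h4.1, h4.2, h5.1, h5.2]
    have hx : |horizB s| ≤ 0.01 := by
      rw [abs_le]; constructor <;> norm_num <;> linarith [h1.1, h1.2]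
    have hxu : horizB s * u ≤ 0.02 := by
      refine (le_abs_self _).trans ?_
      rw [abs_mul]
      refine (mul_le_mul hx hu1 (abs_nonneg _) (by norm_num)).trans (by norm_num)
    have hcs : 0.048 * 0.99 ≤ Real.cos (31 * s) * Real.sin (31 * s) :=
      mul_le_mul (by norm_num; linarith [h2.1]) (by norm_num; linarith [h3.1]) (by norm_num)
        (by linarith [h2.1])
    norm_num at hxu hcs ⊢
    linarith
  have := hanti hs hs' h
  simp only at this
  linarith

theorem centerB_mem : centerB ∈ rangeB := by
  rw [centerB, rangeB]; constructor <;> norm_num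

theorem defectB_centerB : |defectB centerB| ≤ 1 / 10 ^ 16 := by
  have h := approxTable_tableB
  have h1 := abs_le.1 h.horizB
  have h2 := abs_le.1 h.cos_31
  norm_num at h1 h2
  have hx := abs_le.1 (abs_sq_sub_sq_le (M := 1 / 10) h.horizB
    (by rw [abs_le]; constructor <;> linarith [h1.1, h1.2]) (by norm_num [abs_le]))
  have hc := abs_le.1 (abs_sq_sub_sq_le (M := 1 / 10) h.cos_31
    (by rw [abs_le]; constructor <;> linarith [h2.1, h2.2]) (by norm_num [abs_le]))
  have h3 := abs_le.1 h.cos_oneB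
  rw [defectB, abs_le]
  norm_num at hx hc h3 ⊢
  constructor <;> linarith [hx.1, hx.2, hc.1, hc.2, h3.1, h3.2]

/-- Solutions of the closing condition lie in the range. -/
theorem mem_rangeB_of_isAngleB {s : ℝ} (h : IsAngleB s) : s ∈ rangeB := by
  obtain ⟨⟨h0, h1⟩, hF⟩ := (isAngleB_iff s).1 h
  refine ⟨?_, by linarith [pi_div_64_lt]⟩
  by_contra! hlt
  -- For smaller `s`, `cos 31s` is at least about `0.04929`, while the closing side, of length at
  -- most `s < 0.04908`, has it as vertical component.
  have hm : (0.04908 : ℝ) ∈ rangeB := ⟨le_rfl, by norm_num⟩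
  have hg := cos_31_add_le hm centerB_mem (by norm_num [centerB])
  have hc := abs_le.1 approxTable_tableB.cos_31
  have hpi := Real.pi_gt_d6
  have hcos : Real.cos (31 * 0.04908) ≤ Real.cos (31 * s) :=
    Real.cos_le_cos_of_nonneg_of_le_pi (by linarith) (by linarith) (by linarith)
  have hw : Real.cos (31 * s) ≤ 2 * Real.sin (s / 2) := by
    refine le_of_pow_le_pow_left₀ two_ne_zero (two_sin_half_nonneg h0.le (by linarith)) ?_
    rw [defectB] at hF
    rw [two_sin_half_sq]; linarith [sq_nonneg (horizB s)]
  have hle := two_sin_half_le h0.le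
  rw [centerB] at hg hc
  norm_num at hg hc hlt hcos
  linarith [hc.1]

theorem isAngleB_not_lt {s s' : ℝ} (h : IsAngleB s) (h' : IsAngleB s') : ¬ s < s' := by
  intro hlt
  have := defectB_add_le (mem_rangeB_of_isAngleB h) (mem_rangeB_of_isAngleB h') hlt.le
  rw [((isAngleB_iff _).1 h).2, ((isAngleB_iff _).1 h').2] at this
  linarith

theorem isAngleB_unique {s s' : ℝ} (h : IsAngleB s) (h' : IsAngleB s') : s' = s :=
  le_antisymm (not_lt.1 (isAngleB_not_lt h h')) (not_lt.1 (isAngleB_not_lt h' h))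

theorem exists_isAngleB : ∃ s : ℝ, IsAngleB s ∧ |s - centerB| ≤ 1 / 10 ^ 15 := by
  have hcont : Continuous defectB :=
    continuous_iff_continuousAt.2 fun s => (hasDerivAt_defectB s).continuousAt
  have hc := abs_le.1 defectB_centerB
  have hmem : ∀ s, |s - centerB| ≤ 1 / 10 ^ 15 → s ∈ rangeB := fun s hs => by
    rw [abs_le, centerB] at hs
    norm_num at hs
    constructor <;> norm_num <;> linarith [hs.1, hs.2]
  have hl : |centerB - 1 / 10 ^ 15 - centerB| ≤ 1 / 10 ^ 15 := by norm_num [abs_le]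
  have hu : |centerB + 1 / 10 ^ 15 - centerB| ≤ 1 / 10 ^ 15 := by norm_num [abs_le]
  have hlow : 0 ≤ defectB (centerB - 1 / 10 ^ 15) := by
    have h1 := defectB_add_le (hmem _ hl) centerB_mem (by norm_num)
    norm_num at hc h1 ⊢
    linarith [hc.1]
  have hupp : defectB (centerB + 1 / 10 ^ 15) ≤ 0 := by
    have h1 := defectB_add_le centerB_mem (hmem _ hu) (by norm_num)
    norm_num at hc h1 ⊢
    linarith [hc.2]
  obtain ⟨s, ⟨hs1, hs2⟩, hs⟩ := intermediate_value_Icc'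
    (by linarith : centerB - 1 / 10 ^ 15 ≤ centerB + 1 / 10 ^ 15) hcont.continuousOn ⟨hupp, hlow⟩
  have hsc : |s - centerB| ≤ 1 / 10 ^ 15 := abs_le.2 ⟨by linarith, by linarith⟩
  refine ⟨s, (isAngleB_iff s).2 ⟨?_, hs⟩, hsc⟩
  rw [abs_le, centerB] at hsc
  norm_num at hsc
  exact ⟨by linarith [hsc.1], by linarith [hsc.2, pi_div_64_gt]⟩

/-! ### Symmetric polygons -/

section Symmetric

variable {h : Fin 33 → Plane}

theorem symmetricPolygon_neg (h0 : mirror (h 0) = h 0) (h32 : mirror (h 32) = h 32)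
    (i : Fin 64) : symmetricPolygon h (-i) = mirror (symmetricPolygon h i) := by
  fin_cases i <;>
    first | exact h0.symm | exact h32.symm | rfl | exact (mirror_mirror _).symm

theorem symmetricPolygon_side (h0 : mirror (h 0) = h 0) (h32 : mirror (h 32) = h 32) {c : ℝ}
    (hside : ∀ k : Fin 32, dist (h k.castSucc) (h k.succ) = c) (i : Fin 64) :
    dist (symmetricPolygon h i) (symmetricPolygon h (i + 1)) = c := by
  have hhalf : ∀ i : Fin 64, i.val < 32 →
      dist (symmetricPolygon h i) (symmetricPolygon h (i + 1)) = c := by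
    intro i hi
    have hi1 : (i + 1).val = i.val + 1 := by
      rw [Fin.val_add_one_of_lt']; omega
    have e1 : symmetricPolygon h i = h (Fin.castSucc ⟨i.val, hi⟩) := by
      rw [symmetricPolygon]; exact dif_pos (by omega)
    have e2 : symmetricPolygon h (i + 1) = h (Fin.succ ⟨i.val, hi⟩) := by
      rw [symmetricPolygon]
      refine (dif_pos (by omega)).trans (congrArg h (Fin.ext ?_))
      simp [hi1]
    rw [e1, e2, hside]
  rcases lt_or_ge i.val 32 with hi | hi
  · exact hhalf i hi
  -- Reflection sends the side from `i` to `i + 1` to the side from `-(i + 1)` to `-i`, reversed and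
  -- in the first half.
  · have hn : ∀ i : Fin 64, 32 ≤ i.val → (-(i + 1)).val < 32 := by decide +kernel
    have hs : ∀ i : Fin 64, -(i + 1) + 1 = -i := by decide +kernel
    have := hhalf _ (hn i hi)
    rwa [hs, symmetricPolygon_neg h0 h32, symmetricPolygon_neg h0 h32, dist_mirror_mirror,
      dist_comm] at this

theorem perimeter_eq {P : Polygon Plane 64} {c : ℝ} (h : ∀ i, dist (P i) (P (i + 1)) = c) :
    P.perimeter = 64 * c := by
  simp [Polygon.perimeter, h]

end Symmetric

/-! ### Distances along a zigzag path -/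

/-- The segment is a chord of the unit circle about `q` subtending the angle `t`. The sign `ε`
covers upward and downward steps alike. -/
theorem dist_add_smul_dir {ε : ℝ} (hε : ε ^ 2 = 1) (q : Plane) {u v t : ℝ} (h0 : 0 ≤ t)
    (h1 : t ≤ Real.pi) (h : u = v + t ∨ v = u + t) :
    dist (q + ε • dir u) (q + ε • dir v) = 2 * Real.sin (t / 2) := by
  rw [dist_eq_two_sin_half_iff h0 h1]
  have hc : Real.cos t = Real.cos u * Real.cos v + Real.sin u * Real.sin v := by
    rw [← Real.cos_sub]
    rcases h with rfl | rfl
    · congr 1; ring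
    · rw [← Real.cos_neg]; congr 1; ring
  simp only [PiLp.add_apply, PiLp.smul_apply, dir_apply_zero, dir_apply_one, smul_eq_mul]
  rw [hc]
  linear_combination (Real.sin u ^ 2 + Real.cos u ^ 2 + Real.sin v ^ 2 + Real.cos v ^ 2
    - 2 * Real.cos u * Real.cos v - 2 * Real.sin u * Real.sin v) * hε
    + Real.sin_sq_add_cos_sq u + Real.sin_sq_add_cos_sq v

/-- Views a path vertex from its successor, so that both path neighbours of a vertex are expressed
as unit steps of the same sign from it. -/
theorem zigzag_eq_succ_add (l : List ℕ) (t : ℝ) (j : ℕ) :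
    zigzag l t j = zigzag l t (j + 1) + (-1 : ℝ) ^ (j + 1) • dir ((l.getD j 0 : ℕ) * t) := by
  rw [zigzag_succ, pow_succ, mul_neg_one, neg_smul, add_neg_cancel_right]

theorem neg_one_pow_sq (j : ℕ) : ((-1 : ℝ) ^ j) ^ 2 = 1 := by
  rw [← pow_mul, mul_comm, pow_mul, neg_one_sq, one_pow]

section Sides

variable {l : List ℕ} {t k : ℝ} {j : ℕ}

theorem dist_zigzag_add_two (h0 : 0 ≤ t) (h1 : t ≤ Real.pi)
    (h : l.getD (j + 1) 0 = l.getD j 0 + 1) :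
    dist (zigzag l t j) (zigzag l t (j + 2)) = 2 * Real.sin (t / 2) := by
  rw [zigzag_eq_succ_add, zigzag_succ l t (j + 1)]
  exact dist_add_smul_dir (neg_one_pow_sq _) _ h0 h1 (Or.inr (by rw [h]; push_cast; ring))

theorem dist_add_dir_zigzag_succ (h0 : 0 ≤ t) (h1 : t ≤ Real.pi)
    (hj : Even j) (h : k = (l.getD j 0 : ℕ) + 1 ∨ ((l.getD j 0 : ℕ) : ℝ) = k + 1) :
    dist (zigzag l t j + dir (k * t)) (zigzag l t (j + 1)) = 2 * Real.sin (t / 2) := by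
  rw [zigzag_succ, hj.neg_one_pow, ← one_smul ℝ (dir (k * t))]
  exact dist_add_smul_dir (one_pow 2) _ h0 h1
    (h.imp (fun h => by rw [h]; ring) (fun h => by rw [h]; ring))

theorem dist_add_dir_zigzag_pred (h0 : 0 ≤ t) (h1 : t ≤ Real.pi)
    (hj : Odd j) (h : k = (l.getD j 0 : ℕ) + 1 ∨ ((l.getD j 0 : ℕ) : ℝ) = k + 1) :
    dist (zigzag l t (j + 1) + dir (k * t)) (zigzag l t j) = 2 * Real.sin (t / 2) := by
  rw [zigzag_eq_succ_add l t j, hj.add_one.neg_one_pow, ← one_smul ℝ (dir (k * t))]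
  exact dist_add_smul_dir (one_pow 2) _ h0 h1
    (h.imp (fun h => by rw [h]; ring) (fun h => by rw [h]; ring))

theorem dist_sub_dir_zigzag_succ (h0 : 0 ≤ t) (h1 : t ≤ Real.pi)
    (hj : Odd j) (h : k = (l.getD j 0 : ℕ) + 1 ∨ ((l.getD j 0 : ℕ) : ℝ) = k + 1) :
    dist (zigzag l t j - dir (k * t)) (zigzag l t (j + 1)) = 2 * Real.sin (t / 2) := by
  rw [zigzag_succ, hj.neg_one_pow, sub_eq_add_neg, ← neg_one_smul ℝ (dir (k * t))]
  exact dist_add_smul_dir neg_one_sq _ h0 h1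
    (h.imp (fun h => by rw [h]; ring) (fun h => by rw [h]; ring))

theorem dist_sub_dir_zigzag_pred (h0 : 0 ≤ t) (h1 : t ≤ Real.pi)
    (hj : Even j) (h : k = (l.getD j 0 : ℕ) + 1 ∨ ((l.getD j 0 : ℕ) : ℝ) = k + 1) :
    dist (zigzag l t (j + 1) - dir (k * t)) (zigzag l t j) = 2 * Real.sin (t / 2) := by
  rw [zigzag_eq_succ_add l t j, hj.add_one.neg_one_pow, sub_eq_add_neg,
    ← neg_one_smul ℝ (dir (k * t))]
  exact dist_add_smul_dir neg_one_sq _ h0 h1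
    (h.imp (fun h => by rw [h]; ring) (fun h => by rw [h]; ring))

theorem dist_add_dir_add_dir (h0 : 0 ≤ t) (h1 : t ≤ Real.pi) (q : Plane) :
    dist (q + dir ((k + 1) * t)) (q + dir (k * t))
    = 2 * Real.sin (t / 2) := by
  have := dist_add_smul_dir (one_pow 2) q h0 h1 (u := (k + 1) * t) (v := k * t) (by left; ring)
  rwa [one_smul, one_smul] at this

theorem dist_zigzag_one_top (h0 : 0 ≤ t) (h1 : t ≤ Real.pi)
    (h : l.getD 0 0 = 1) :
    dist (zigzag l t 1) !₂[0, 1] = 2 * Real.sin (t / 2) := by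
  have := dist_add_smul_dir (one_pow 2) 0 h0 h1 (u := t) (v := 0) (by simp)
  convert! this using 2
  · rw [zigzag, Finset.sum_range_one, h]; simp
  · exact plane_ext (by simp) (by simp)

end Sides

theorem norm_dir (θ : ℝ) : ‖dir θ‖ = 1 := by
  rw [← dist_zero_right, ← sq_eq_sq₀ dist_nonneg zero_le_one, plane_dist_sq]
  simp

theorem dist_zigzag_succ (l : List ℕ) (t : ℝ) (j : ℕ) :
    dist (zigzag l t j) (zigzag l t (j + 1)) = 1 := by
  rw [zigzag_succ, dist_self_add_right, norm_smul, norm_pow, norm_neg, norm_one, one_pow,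
    norm_dir, one_mul]

theorem dist_self_add_dir (p : Plane) (θ : ℝ) : dist p (p + dir θ) = 1 := by
  rw [dist_self_add_right, norm_dir]

theorem dist_self_sub_dir (p : Plane) (θ : ℝ) : dist p (p - dir θ) = 1 := by
  rw [dist_self_sub_right, norm_dir]

theorem mirror_zigzag_zero (l : List ℕ) (t : ℝ) : mirror (zigzag l t 0) = zigzag l t 0 :=
  plane_ext (by simp [zigzag]) (by simp)

theorem mirror_top : mirror !₂[0, 1] = !₂[0, 1] := plane_ext (by simp) (by simp)

/-! ### The sides of `B₆₄` -/

/-- The vertices `v₀, …, v₃₂` of `B₆₄`. -/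
def halfB (t : ℝ) : Fin 33 → Plane :=
  let p : ℕ → Plane := zigzag bAngles t
  ![
    -- `v₀, …, v₇`
    p 0, mirror (p 1 - dir (2 * t)), mirror (p 2), mirror (p 4),
    mirror (p 6), mirror (p 7 - dir (10 * t)), mirror (p 8), mirror (p 10),
    -- `v₈, …, v₁₅`
    mirror (p 12), mirror (p 13 - dir (18 * t)), mirror (p 14), mirror (p 16),
    mirror (p 18), mirror (p 19 - dir (26 * t)), mirror (p 20), mirror (p 22),
    -- `v₁₆, …, v₂₃`
    p 23, p 22 + dir (30 * t), p 21, p 19, p 17, p 16 + dir (22 * t), p 15, p 13,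
    -- `v₂₄, …, v₃₂`
    p 11, p 10 + dir (14 * t), p 9, p 7, p 5, p 4 + dir (6 * t), p 3, p 1, !₂[0, 1]]

theorem halfB_side {t : ℝ} (h : IsAngleB t) (k : Fin 32) :
    dist (halfB t k.castSucc) (halfB t k.succ) = 2 * Real.sin (t / 2) := by
  have h0 : 0 ≤ t := h.1.1.le
  have h1 : t ≤ Real.pi := h.1.2.le.trans (by linarith [Real.pi_pos])
  fin_cases k
  · exact (congrArg (dist · _) (mirror_zigzag_zero _ _).symm).trans ((dist_mirror_mirror _ _).trans
      ((dist_comm _ _).trans (dist_sub_dir_zigzag_pred h0 h1 (j := 0) (by decide)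
      (by norm_num [bAngles]))))
  · exact (dist_mirror_mirror _ _).trans (dist_sub_dir_zigzag_succ h0 h1 (j := 1) (by decide)
      (by norm_num [bAngles]))
  · exact (dist_mirror_mirror _ _).trans (dist_zigzag_add_two h0 h1 (j := 2) rfl)
  · exact (dist_mirror_mirror _ _).trans (dist_zigzag_add_two h0 h1 (j := 4) rfl)
  · exact (dist_mirror_mirror _ _).trans ((dist_comm _ _).trans (dist_sub_dir_zigzag_pred h0 h1
      (j := 6) (by decide) (by norm_num [bAngles])))
  · exact (dist_mirror_mirror _ _).trans (dist_sub_dir_zigzag_succ h0 h1 (j := 7) (by decide)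
      (by norm_num [bAngles]))
  · exact (dist_mirror_mirror _ _).trans (dist_zigzag_add_two h0 h1 (j := 8) rfl)
  · exact (dist_mirror_mirror _ _).trans (dist_zigzag_add_two h0 h1 (j := 10) rfl)
  · exact (dist_mirror_mirror _ _).trans ((dist_comm _ _).trans (dist_sub_dir_zigzag_pred h0 h1
      (j := 12) (by decide) (by norm_num [bAngles])))
  · exact (dist_mirror_mirror _ _).trans (dist_sub_dir_zigzag_succ h0 h1 (j := 13) (by decide)
      (by norm_num [bAngles]))
  · exact (dist_mirror_mirror _ _).trans (dist_zigzag_add_two h0 h1 (j := 14) rfl)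
  · exact (dist_mirror_mirror _ _).trans (dist_zigzag_add_two h0 h1 (j := 16) rfl)
  · exact (dist_mirror_mirror _ _).trans ((dist_comm _ _).trans (dist_sub_dir_zigzag_pred h0 h1
      (j := 18) (by decide) (by norm_num [bAngles])))
  · exact (dist_mirror_mirror _ _).trans (dist_sub_dir_zigzag_succ h0 h1 (j := 19) (by decide)
      (by norm_num [bAngles]))
  · exact (dist_mirror_mirror _ _).trans (dist_zigzag_add_two h0 h1 (j := 20) rfl)
  -- The side `v₁₅ v₁₆`, mirror image of `v₄₉ v₄₈`: the closing condition.
  · exact (dist_mirror_mirror _ _).symm.trans h.2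
  · exact ((dist_comm _ _).trans (dist_add_dir_zigzag_succ h0 h1 (j := 22) (by decide)
      (by norm_num [bAngles])))
  · exact (dist_add_dir_zigzag_pred h0 h1 (j := 21) (by decide) (by norm_num [bAngles]))
  · exact ((dist_comm _ _).trans (dist_zigzag_add_two h0 h1 (j := 19) rfl))
  · exact ((dist_comm _ _).trans (dist_zigzag_add_two h0 h1 (j := 17) rfl))
  · exact ((dist_comm _ _).trans (dist_add_dir_zigzag_succ h0 h1 (j := 16) (by decide)
      (by norm_num [bAngles])))
  · exact (dist_add_dir_zigzag_pred h0 h1 (j := 15) (by decide) (by norm_num [bAngles]))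
  · exact ((dist_comm _ _).trans (dist_zigzag_add_two h0 h1 (j := 13) rfl))
  · exact ((dist_comm _ _).trans (dist_zigzag_add_two h0 h1 (j := 11) rfl))
  · exact ((dist_comm _ _).trans (dist_add_dir_zigzag_succ h0 h1 (j := 10) (by decide)
      (by norm_num [bAngles])))
  · exact (dist_add_dir_zigzag_pred h0 h1 (j := 9) (by decide) (by norm_num [bAngles]))
  · exact ((dist_comm _ _).trans (dist_zigzag_add_two h0 h1 (j := 7) rfl))
  · exact ((dist_comm _ _).trans (dist_zigzag_add_two h0 h1 (j := 5) rfl))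
  · exact ((dist_comm _ _).trans (dist_add_dir_zigzag_succ h0 h1 (j := 4) (by decide)
      (by norm_num [bAngles])))
  · exact (dist_add_dir_zigzag_pred h0 h1 (j := 3) (by decide) (by norm_num [bAngles]))
  · exact ((dist_comm _ _).trans (dist_zigzag_add_two h0 h1 (j := 1) rfl))
  · exact dist_zigzag_one_top h0 h1 rfl

theorem polygonB_side {t : ℝ} (h : IsAngleB t) (i : Fin 64) :
    dist (polygonB t i) (polygonB t (i + 1)) = 2 * Real.sin (t / 2) :=
  symmetricPolygon_side (mirror_zigzag_zero bAngles t) mirror_top (halfB_side h) i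

/-! ### The sides of `Z₆₄` -/

/-- The vertices `v₀, …, v₃₂` of `Z₆₄`. -/
def halfZ (t y : ℝ) : Fin 33 → Plane :=
  let p : ℕ → Plane := zigzag zAngles t
  ![
    -- `v₀, …, v₇`
    p 0, mirror (p 2), mirror (p 3 - dir (4 * t)), mirror (p 4),
    mirror (p 6), mirror (p 7 - dir (9 * t)), mirror (p 8), mirror (p 10),
    -- `v₈, …, v₁₃`
    mirror (p 12), mirror (p 14), mirror (p 16), mirror (p 18), mirror (p 20), mirror (p 22),
    -- `v₁₄, v₁₅`
    !₂[1 / 2, y], !₂[-1 / 2 + Real.cos t, y + Real.sin t],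
    -- `v₁₆, …, v₂₂`
    p 23, p 22 + dir (28 * t), p 22 + dir (27 * t), p 21, p 20 + dir (24 * t), p 19,
    p 18 + dir (21 * t),
    -- `v₂₃, …, v₃₂`
    p 17, p 15, p 13, p 11, p 9, p 7, p 5, p 3, p 1, !₂[0, 1]]

theorem halfZ_side {t y : ℝ} (h : SystemZ t y) (k : Fin 32) :
    dist (halfZ t y k.castSucc) (halfZ t y k.succ) = 2 * Real.sin (t / 2) := by
  have h0 : 0 ≤ t := h.1.1.le
  have h1 : t ≤ Real.pi := h.1.2.le.trans (by linarith [Real.pi_pos])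
  fin_cases k
  · exact (congrArg (dist · _) (mirror_zigzag_zero _ _).symm).trans ((dist_mirror_mirror _ _).trans
      (dist_zigzag_add_two h0 h1 (j := 0) rfl))
  · exact (dist_mirror_mirror _ _).trans ((dist_comm _ _).trans (dist_sub_dir_zigzag_pred h0 h1
      (j := 2) (by decide) (by norm_num [zAngles])))
  · exact (dist_mirror_mirror _ _).trans (dist_sub_dir_zigzag_succ h0 h1 (j := 3) (by decide)
      (by norm_num [zAngles]))
  · exact (dist_mirror_mirror _ _).trans (dist_zigzag_add_two h0 h1 (j := 4) rfl)
  · exact (dist_mirror_mirror _ _).trans ((dist_comm _ _).trans (dist_sub_dir_zigzag_pred h0 h1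
      (j := 6) (by decide) (by norm_num [zAngles])))
  · exact (dist_mirror_mirror _ _).trans (dist_sub_dir_zigzag_succ h0 h1 (j := 7) (by decide)
      (by norm_num [zAngles]))
  · exact (dist_mirror_mirror _ _).trans (dist_zigzag_add_two h0 h1 (j := 8) rfl)
  · exact (dist_mirror_mirror _ _).trans (dist_zigzag_add_two h0 h1 (j := 10) rfl)
  · exact (dist_mirror_mirror _ _).trans (dist_zigzag_add_two h0 h1 (j := 12) rfl)
  · exact (dist_mirror_mirror _ _).trans (dist_zigzag_add_two h0 h1 (j := 14) rfl)
  · exact (dist_mirror_mirror _ _).trans (dist_zigzag_add_two h0 h1 (j := 16) rfl)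
  · exact (dist_mirror_mirror _ _).trans (dist_zigzag_add_two h0 h1 (j := 18) rfl)
  · exact (dist_mirror_mirror _ _).trans (dist_zigzag_add_two h0 h1 (j := 20) rfl)
  -- The side `v₁₃ v₁₄`, mirror image of `v₅₁ v₅₀`: the first equation of the system.
  · exact (dist_mirror_mirror _ _).symm.trans ((congrArg (dist · _) (mirror_mirror _)).trans
      ((congrArg (dist · _) (mirror_mirror _).symm).trans h.2.1))
  -- Both `v₁₄` and `v₁₅` are at distance one from `v₅₀`, in directions differing by `t`.
  · change dist !₂[(1 : ℝ) / 2, y] !₂[-1 / 2 + Real.cos t, y + Real.sin t] = _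
    rw [dist_eq_two_sin_half_iff h0 h1]
    simp only [Matrix.cons_val_zero, Matrix.cons_val_one]
    linear_combination Real.sin_sq_add_cos_sq t
  · exact (dist_comm _ _).trans h.2.2
  · exact ((dist_comm _ _).trans (dist_add_dir_zigzag_succ h0 h1 (j := 22) (by decide)
      (by norm_num [zAngles])))
  · change dist (zigzag zAngles t 22 + dir (28 * t)) (zigzag zAngles t 22 + dir (27 * t)) = _
    rw [show (28 : ℝ) = 27 + 1 by norm_num]
    exact dist_add_dir_add_dir h0 h1 _
  · exact (dist_add_dir_zigzag_pred h0 h1 (j := 21) (by decide) (by norm_num [zAngles]))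
  · exact ((dist_comm _ _).trans (dist_add_dir_zigzag_succ h0 h1 (j := 20) (by decide)
      (by norm_num [zAngles])))
  · exact (dist_add_dir_zigzag_pred h0 h1 (j := 19) (by decide) (by norm_num [zAngles]))
  · exact ((dist_comm _ _).trans (dist_add_dir_zigzag_succ h0 h1 (j := 18) (by decide)
      (by norm_num [zAngles])))
  · exact (dist_add_dir_zigzag_pred h0 h1 (j := 17) (by decide) (by norm_num [zAngles]))
  · exact ((dist_comm _ _).trans (dist_zigzag_add_two h0 h1 (j := 15) rfl))
  · exact ((dist_comm _ _).trans (dist_zigzag_add_two h0 h1 (j := 13) rfl))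
  · exact ((dist_comm _ _).trans (dist_zigzag_add_two h0 h1 (j := 11) rfl))
  · exact ((dist_comm _ _).trans (dist_zigzag_add_two h0 h1 (j := 9) rfl))
  · exact ((dist_comm _ _).trans (dist_zigzag_add_two h0 h1 (j := 7) rfl))
  · exact ((dist_comm _ _).trans (dist_zigzag_add_two h0 h1 (j := 5) rfl))
  · exact ((dist_comm _ _).trans (dist_zigzag_add_two h0 h1 (j := 3) rfl))
  · exact ((dist_comm _ _).trans (dist_zigzag_add_two h0 h1 (j := 1) rfl))
  · exact dist_zigzag_one_top h0 h1 rfl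

theorem polygonZ_side {t y : ℝ} (h : SystemZ t y) (i : Fin 64) :
    dist (polygonZ t y i) (polygonZ t y (i + 1)) = 2 * Real.sin (t / 2) :=
  symmetricPolygon_side (mirror_zigzag_zero zAngles t) mirror_top (halfZ_side h) i

theorem polygonZ_neg (t y : ℝ) (i : Fin 64) : polygonZ t y (-i) = mirror (polygonZ t y i) :=
  symmetricPolygon_neg (h := halfZ t y) (mirror_zigzag_zero zAngles t) mirror_top i

/-! ### The diameters of `Z₆₄` -/

theorem dist_eq_one_of_mem_pathEdges {P : Polygon Plane 64} {l : List (Fin 64)} {f : ℕ → Plane}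
    (hf : ∀ j, dist (f j) (f (j + 1)) = 1) (h : ∀ j (hj : j < l.length), P l[j] = f j)
    (e : Fin 64 × Fin 64) (he : e ∈ pathEdges l) : dist (P e.1) (P e.2) = 1 := by
  obtain ⟨j, hj, rfl⟩ := List.mem_iff_getElem.1 he
  simp only [pathEdges, List.length_zip, List.length_tail] at hj
  simp only [pathEdges, List.getElem_zip, List.getElem_tail]
  rw [h _ (by omega), h _ (by omega), hf]

theorem polygonZ_dist_eq_one (t y : ℝ) :
    ∀ e ∈ zHalfEdges, dist (polygonZ t y e.1) (polygonZ t y e.2) = 1 := by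
  intro e he
  simp only [zHalfEdges, List.mem_append] at he
  rcases he with ((he | he) | he) | he
  · obtain rfl := List.mem_singleton.1 he
    change dist (zigzag zAngles t 0) !₂[0, 1] = 1
    rw [← sq_eq_sq₀ dist_nonneg zero_le_one, plane_dist_sq]
    simp [zigzag]
  · refine dist_eq_one_of_mem_pathEdges (dist_zigzag_succ zAngles t) (fun j hj => ?_) e he
    simp only [List.length_cons, List.length_nil] at hj
    interval_cases j <;> first | rfl | exact mirror_mirror _
  · simp only [List.mem_cons, List.not_mem_nil, or_false] at he
    rcases he with rfl | rfl | rfl | rfl | rfl | rfl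
    · exact (congrArg (dist _) (mirror_mirror _)).trans (dist_self_sub_dir _ _)
    · exact (congrArg (dist _) (mirror_mirror _)).trans (dist_self_sub_dir _ _)
    · exact (congrArg (dist · _) (mirror_mirror _)).trans (dist_self_add_dir _ _)
    · exact (congrArg (dist · _) (mirror_mirror _)).trans (dist_self_add_dir _ _)
    · exact (congrArg (dist · _) (mirror_mirror _)).trans (dist_self_add_dir _ _)
    · exact (congrArg (dist · _) (mirror_mirror _)).trans (dist_self_add_dir _ _)
  · have h1 : dist !₂[-1 / 2 + Real.cos t, y + Real.sin t] (mirror !₂[(1 : ℝ) / 2, y]) = 1 := by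
      rw [← sq_eq_sq₀ dist_nonneg zero_le_one, plane_dist_sq]
      simp only [mirror_apply_zero, mirror_apply_one, Matrix.cons_val_zero, Matrix.cons_val_one]
      linear_combination Real.sin_sq_add_cos_sq t
    have h2 : dist (mirror !₂[(1 : ℝ) / 2, y]) !₂[1 / 2, y] = 1 := by
      rw [← sq_eq_sq₀ dist_nonneg zero_le_one, plane_dist_sq]
      norm_num
    have h3 : dist !₂[(1 : ℝ) / 2, y] (mirror !₂[-1 / 2 + Real.cos t, y + Real.sin t]) = 1 := by
      rw [← dist_mirror_mirror, mirror_mirror, dist_comm, h1]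
    simp only [pathEdges, List.tail_cons, List.zip_cons_cons, List.zip_nil_right, List.mem_cons,
      List.not_mem_nil, or_false] at he
    rcases he with rfl | rfl | rfl
    · exact h1
    · exact h2
    · exact h3

theorem polygonZ_dist_eq_one_of_adj {t y : ℝ} {i j : Fin 64} (h : graphZ.Adj i j) :
    dist (polygonZ t y i) (polygonZ t y j) = 1 := by
  have key : ∀ i j : Fin 64, (i, j) ∈ zHalfEdges ∨ (-i, -j) ∈ zHalfEdges →
      dist (polygonZ t y i) (polygonZ t y j) = 1 := by
    rintro i j (h | h)
    · exact polygonZ_dist_eq_one t y (i, j) h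
    · have := polygonZ_dist_eq_one t y (-i, -j) h
      simp only at this
      rwa [polygonZ_neg, polygonZ_neg, dist_mirror_mirror] at this
  rw [graphZ, SimpleGraph.fromRel_adj] at h
  rcases h.2 with h | h
  · exact key i j h
  · rw [dist_comm]; exact key j i h

/-! ### Rational approximations of the vertices of `Z₆₄` -/

/-- The point `p` has coordinates `q`, in units of `10⁻²⁰`, up to `ε`. -/
def Near (p : Plane) (q : ℤ × ℤ) (ε : ℝ) : Prop :=
  |p 0 - q.1 / 10 ^ 20| ≤ ε ∧ |p 1 - q.2 / 10 ^ 20| ≤ ε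

/-- The point `p` has coordinates `v`, in units of `10⁻⁸`, up to `2 * 10⁻⁸`. -/
def Rounds (p : Plane) (v : ℤ × ℤ) : Prop :=
  |p 0 - v.1 / 10 ^ 8| ≤ 2 / 10 ^ 8 ∧ |p 1 - v.2 / 10 ^ 8| ≤ 2 / 10 ^ 8

section Near

variable {p p' : Plane} {q q' v : ℤ × ℤ} {ε ε' t κ : ℝ}

theorem Near.add (h : Near p q ε) (h' : Near p' q' ε') :
    Near (p + p') (q.1 + q'.1, q.2 + q'.2) (ε + ε') := by
  simp only [Near, abs_le, PiLp.add_apply] at *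
  push_cast
  obtain ⟨⟨_, _⟩, _, _⟩ := h
  obtain ⟨⟨_, _⟩, _, _⟩ := h'
  refine ⟨⟨?_, ?_⟩, ?_, ?_⟩ <;> linarith

theorem Near.sub (h : Near p q ε) (h' : Near p' q' ε') :
    Near (p - p') (q.1 - q'.1, q.2 - q'.2) (ε + ε') := by
  simp only [Near, abs_le, PiLp.sub_apply] at *
  push_cast
  obtain ⟨⟨_, _⟩, _, _⟩ := h
  obtain ⟨⟨_, _⟩, _, _⟩ := h'
  refine ⟨⟨?_, ?_⟩, ?_, ?_⟩ <;> linarith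

theorem Near.mirror (h : Near p q ε) : Near (mirror p) (-q.1, q.2) ε := by
  refine ⟨?_, h.2⟩
  rw [mirror_apply_zero, ← abs_neg]
  convert! h.1 using 2
  push_cast; ring

/-- One unit of `10⁻⁸` is allowed for rounding the integer entry and one for the error `ε`. -/
theorem Near.round (h : Near p q ε) (hq : |q.1 - 10 ^ 12 * v.1| ≤ 10 ^ 12 ∧
    |q.2 - 10 ^ 12 * v.2| ≤ 10 ^ 12) (hε : ε ≤ 1 / 10 ^ 8 := by norm_num) : Rounds p v := by
  have key : ∀ x : ℝ, ∀ a b : ℤ, |x - a / 10 ^ 20| ≤ ε → |a - 10 ^ 12 * b| ≤ 10 ^ 12 →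
      |x - b / 10 ^ 8| ≤ 2 / 10 ^ 8 := by
    intro x a b h1 h2
    have h3 : |((a - 10 ^ 12 * b : ℤ) : ℝ)| ≤ (10 ^ 12 : ℤ) := by exact_mod_cast h2
    push_cast at h3
    rw [abs_le] at *
    norm_num at h1 h3 hε ⊢
    constructor <;> linarith [h1.1, h1.2, h3.1, h3.2]
  exact ⟨key _ _ _ h.1 hq.1, key _ _ _ h.2 hq.2⟩

theorem near_zigzag (h : ApproxTable tableZ t κ) (hκ : κ ≤ 1 / 10 ^ 14) {j : ℕ} (hj : j ≤ 23) :
    Near (zigzag zAngles t j) (altSum (tableSin tableZ) zAngles j,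
      altSum (tableCos tableZ) zAngles j) (1 / 10 ^ 10) := by
  have hw : ∑ i ∈ Finset.range j, zAngles.getD i 0 ≤ 322 :=
    (Finset.sum_le_sum_of_subset (Finset.range_mono hj)).trans (by decide)
  have hκ0 : 0 ≤ κ := by simpa using (abs_nonneg _).trans (h 1 (by norm_num)).1
  have hw' : ((∑ i ∈ Finset.range j, zAngles.getD i 0 : ℕ) : ℝ) * κ ≤ 1 / 10 ^ 10 := by
    refine (mul_le_mul (Nat.cast_le.2 hw) hκ hκ0 (by norm_num)).trans (by norm_num)
  exact ⟨by rw [zigzag_apply_zero]; exact (h.altSum_sin zAngles_le j).trans hw',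
    by rw [zigzag_apply_one]; exact (h.altSum_cos zAngles_le j).trans hw'⟩

theorem near_dir (h : ApproxTable tableZ t κ) (hκ : κ ≤ 1 / 10 ^ 14) {a : ℕ} (ha : a ≤ 31) :
    Near (dir (a * t)) (tableSin tableZ a, tableCos tableZ a) (1 / 10 ^ 10) := by
  have hκ0 : 0 ≤ κ := by simpa using (abs_nonneg _).trans (h 1 (by norm_num)).1
  have ha' : (a : ℝ) ≤ 31 := by exact_mod_cast ha
  have hw : a * κ ≤ 1 / 10 ^ 10 :=
    (mul_le_mul ha' hκ hκ0 (by norm_num)).trans (by norm_num)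
  exact ⟨(h a ha).2.trans hw, (h a ha).1.trans hw⟩

end Near

/-- The vertices `v₀, …, v₃₂` of `Z₆₄`, in units of `10⁻⁸`. -/
def vertexTable : List (ℤ × ℤ) :=
  [(0, 0), (4894943, 361072), (9730925, 1200194), (14519908, 2275596),
    (19180423, 3815221), (23667587, 5804242), (28051749, 8011042), (32198496, 10636939),
    (36067893, 13656643), (39622675, 17041074), (42828608, 20757636), (45654816, 24770539),
    (47861621, 29154699), (49401251, 33815212), (50000000, 38686798), (49879546, 43593562),
    (49516387, 48488351), (48677260, 53324332), (47601854, 58113314), (46292759, 62843759),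
    (44526303, 67423113), (42537277, 71910275), (40118010, 76180871), (37492110, 80327615),
    (34472401, 84197009), (31087967, 87751788), (27371401, 90957717), (23358496, 93783921),
    (19087897, 96203184), (14508541, 97969635), (9778095, 99278725), (4906764, 99879546),
    (0, 100000000)]

/-- The vertices of `Z₆₄`, in units of `10⁻⁸`. -/
def vertexApprox (i : Fin 64) : ℤ × ℤ :=
  if i.val ≤ 32 then vertexTable.getD i (0, 0)
  else (-(vertexTable.getD (64 - i) (0, 0)).1, (vertexTable.getD (64 - i) (0, 0)).2)

/-- Positivity selects the root of `w² = V₁(t)`, so bounds on the square pin down `w`, and with the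
height of `v₅₁` also `y`. -/
theorem abs_riseZ_sub_le {t y κ : ℝ} (hs : SystemZ t y) (h : ApproxTable tableZ t κ)
    (hκ : κ ≤ 1 / 10 ^ 14) : |riseZ t y - 0.0487158536| ≤ 5 / 10 ^ 10 := by
  have hp := (riseZ_pos_of_systemZ hs).1
  have hA := ((systemZ_iff t y).1 hs).2.1
  have h1 := h.horizZ₁
  have h1' := abs_le.1 h1
  norm_num at h1' hκ
  have h2 := abs_le.1 (abs_sq_sub_sq_le (M := 1 / 100) h1
    (by rw [abs_le]; constructor <;> linarith [h1'.1, h1'.2]) (by norm_num [abs_le]))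
  have h3 := abs_le.1 h.cos_one
  rw [vertSqZ₁] at hA
  norm_num at h2 h3
  rw [abs_le]
  constructor
  · have : (0.0487158531 : ℝ) ≤ riseZ t y := by
      refine le_of_pow_le_pow_left₀ two_ne_zero hp.le ?_
      rw [hA]; norm_num; linarith [h2.2, h3.2]
    norm_num at this ⊢; linarith
  · have : riseZ t y ≤ (0.0487158541 : ℝ) := by
      refine le_of_pow_le_pow_left₀ two_ne_zero (by norm_num) ?_
      rw [hA]; norm_num; linarith [h2.1, h3.1]
    norm_num at this ⊢; linarith

theorem halfZ_rounds {t y κ : ℝ} (hs : SystemZ t y) (h : ApproxTable tableZ t κ)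
    (hκ : κ ≤ 1 / 10 ^ 14) (i : Fin 33) : Rounds (halfZ t y i) (vertexTable.getD i (0, 0)) := by
  have hy : |y - 0.3868679786| ≤ 1 / 10 ^ 9 := by
    have h1 := abs_le.1 (abs_riseZ_sub_le hs h hκ)
    have h2 := abs_le.1 h.altSum_cos_zAngles
    rw [riseZ] at h1
    rw [abs_le]
    norm_num at h1 h2 hκ ⊢
    constructor <;> linarith [h1.1, h1.2, h2.1, h2.2]
  rw [abs_le] at hy
  have hc := abs_le.1 h.cos_one
  have hsin := abs_le.1 h.sin_one
  norm_num at hy hc hsin hκ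
  have hv14 : Rounds !₂[1 / 2, y] (vertexTable.getD 14 (0, 0)) := by
    norm_num [Rounds, vertexTable, abs_le]
    constructor <;> linarith [hy.1, hy.2]
  have hv15 : Rounds !₂[-1 / 2 + Real.cos t, y + Real.sin t] (vertexTable.getD 15 (0, 0)) := by
    norm_num [Rounds, vertexTable, abs_le]
    refine ⟨⟨?_, ?_⟩, ?_, ?_⟩ <;> linarith [hy.1, hy.2, hc.1, hc.2, hsin.1, hsin.2]
  have hv32 : Rounds !₂[0, 1] (vertexTable.getD 32 (0, 0)) := by
    norm_num [Rounds, vertexTable]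
  have hκ : κ ≤ 1 / 10 ^ 14 := by norm_num; exact hκ
  fin_cases i
  · exact (near_zigzag h hκ (j := 0) (by norm_num)).round (by decide +kernel)
  · exact (near_zigzag h hκ (j := 2) (by norm_num)).mirror.round (by decide +kernel)
  · exact ((near_zigzag h hκ (j := 3) (by norm_num)).sub (near_dir h hκ (a := 4)
      (by norm_num))).mirror.round (by decide +kernel)
  · exact (near_zigzag h hκ (j := 4) (by norm_num)).mirror.round (by decide +kernel)
  · exact (near_zigzag h hκ (j := 6) (by norm_num)).mirror.round (by decide +kernel)
  · exact ((near_zigzag h hκ (j := 7) (by norm_num)).sub (near_dir h hκ (a := 9)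
      (by norm_num))).mirror.round (by decide +kernel)
  · exact (near_zigzag h hκ (j := 8) (by norm_num)).mirror.round (by decide +kernel)
  · exact (near_zigzag h hκ (j := 10) (by norm_num)).mirror.round (by decide +kernel)
  · exact (near_zigzag h hκ (j := 12) (by norm_num)).mirror.round (by decide +kernel)
  · exact (near_zigzag h hκ (j := 14) (by norm_num)).mirror.round (by decide +kernel)
  · exact (near_zigzag h hκ (j := 16) (by norm_num)).mirror.round (by decide +kernel)
  · exact (near_zigzag h hκ (j := 18) (by norm_num)).mirror.round (by decide +kernel)
  · exact (near_zigzag h hκ (j := 20) (by norm_num)).mirror.round (by decide +kernel)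
  · exact (near_zigzag h hκ (j := 22) (by norm_num)).mirror.round (by decide +kernel)
  · exact hv14
  · exact hv15
  · exact (near_zigzag h hκ (j := 23) (by norm_num)).round (by decide +kernel)
  · exact ((near_zigzag h hκ (j := 22) (by norm_num)).add (near_dir h hκ (a := 28)
      (by norm_num))).round (by decide +kernel)
  · exact ((near_zigzag h hκ (j := 22) (by norm_num)).add (near_dir h hκ (a := 27)
      (by norm_num))).round (by decide +kernel)
  · exact (near_zigzag h hκ (j := 21) (by norm_num)).round (by decide +kernel)
  · exact ((near_zigzag h hκ (j := 20) (by norm_num)).add (near_dir h hκ (a := 24)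
      (by norm_num))).round (by decide +kernel)
  · exact (near_zigzag h hκ (j := 19) (by norm_num)).round (by decide +kernel)
  · exact ((near_zigzag h hκ (j := 18) (by norm_num)).add (near_dir h hκ (a := 21)
      (by norm_num))).round (by decide +kernel)
  · exact (near_zigzag h hκ (j := 17) (by norm_num)).round (by decide +kernel)
  · exact (near_zigzag h hκ (j := 15) (by norm_num)).round (by decide +kernel)
  · exact (near_zigzag h hκ (j := 13) (by norm_num)).round (by decide +kernel)
  · exact (near_zigzag h hκ (j := 11) (by norm_num)).round (by decide +kernel)
  · exact (near_zigzag h hκ (j := 9) (by norm_num)).round (by decide +kernel)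
  · exact (near_zigzag h hκ (j := 7) (by norm_num)).round (by decide +kernel)
  · exact (near_zigzag h hκ (j := 5) (by norm_num)).round (by decide +kernel)
  · exact (near_zigzag h hκ (j := 3) (by norm_num)).round (by decide +kernel)
  · exact (near_zigzag h hκ (j := 1) (by norm_num)).round (by decide +kernel)
  · exact hv32

theorem polygonZ_rounds {t y κ : ℝ} (hs : SystemZ t y) (h : ApproxTable tableZ t κ)
    (hκ : κ ≤ 1 / 10 ^ 14) (i : Fin 64) : Rounds (polygonZ t y i) (vertexApprox i) := by
  have hr := halfZ_rounds hs h hκ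
  by_cases hi : i.val ≤ 32
  · have e : polygonZ t y i = halfZ t y ⟨i.val, by omega⟩ := dif_pos hi
    rw [e, vertexApprox, if_pos hi]
    exact hr ⟨i.val, by omega⟩
  · have e : polygonZ t y i = mirror (halfZ t y ⟨64 - i.val, by omega⟩) := dif_neg hi
    rw [e, vertexApprox, if_neg hi]
    refine ⟨?_, (hr ⟨64 - i.val, by omega⟩).2⟩
    rw [mirror_apply_zero, ← abs_neg]
    convert! (hr ⟨64 - i.val, by omega⟩).1 using 2
    push_cast; ring

/-! ### Convexity and diameter of `Z₆₄` -/

/-- The orientation determinant of three integer points. -/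
def intOrient (a b c : ℤ × ℤ) : ℤ :=
  (b.1 - a.1) * (c.2 - a.2) - (b.2 - a.2) * (c.1 - a.1)

/-- The square of the distance of two integer points. -/
def intDistSq (a b : ℤ × ℤ) : ℤ := (a.1 - b.1) ^ 2 + (a.2 - b.2) ^ 2

theorem abs_vertexApprox_le :
    ∀ i, |(vertexApprox i).1| ≤ 10 ^ 8 ∧ |(vertexApprox i).2| ≤ 10 ^ 8 := by decide +kernel

/-- In true scale the margin is `10⁻⁴`, against an error of at most `4 · 10⁻⁷` from the rounded
coordinates. -/
theorem le_intOrient_vertexApprox : ∀ i k : Fin 64, k ≠ i → k ≠ i + 1 →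
    10 ^ 12 ≤ intOrient (vertexApprox i) (vertexApprox (i + 1)) (vertexApprox k) := by
  decide +kernel

/-- Pairs outside the prescribed graph have squared distance at most `1 - 10⁻⁵`, again against an
error of at most `4 · 10⁻⁷`. -/
theorem intDistSq_vertexApprox_le : ∀ i j : Fin 64,
    intDistSq (vertexApprox i) (vertexApprox j) ≤ 10 ^ 16 - 10 ^ 11 ∨
      i ≠ j ∧ (((i, j) ∈ zHalfEdges ∨ (-i, -j) ∈ zHalfEdges) ∨
        ((j, i) ∈ zHalfEdges ∨ (-j, -i) ∈ zHalfEdges)) := by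
  decide +kernel

theorem abs_sub_sub_le {x x' : ℝ} {a a' : ℤ} (h : |x - a / 10 ^ 8| ≤ 2 / 10 ^ 8)
    (h' : |x' - a' / 10 ^ 8| ≤ 2 / 10 ^ 8) :
    |(x - x') - (a - a') / 10 ^ 8| ≤ 4 / 10 ^ 8 := by
  rw [abs_le] at *
  norm_num at *
  constructor <;> linarith [h.1, h.2, h'.1, h'.2]

theorem abs_int_sub_div_le {a a' : ℤ} (h : |a| ≤ 10 ^ 8) (h' : |a'| ≤ 10 ^ 8) :
    |((a : ℝ) - a') / 10 ^ 8| ≤ 2 := by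
  have h1 : |(a : ℝ)| ≤ 10 ^ 8 := by exact_mod_cast h
  have h2 : |(a' : ℝ)| ≤ 10 ^ 8 := by exact_mod_cast h'
  rw [abs_div, abs_of_pos (by positivity : (0 : ℝ) < 10 ^ 8), div_le_iff₀ (by positivity)]
  linarith [abs_sub (a : ℝ) a']

theorem abs_mul_sub_mul_le {u v u' v' e : ℝ} (hu : |u - u'| ≤ e) (hv : |v - v'| ≤ e)
    (hu' : |u'| ≤ 2) (hv' : |v'| ≤ 2) (he : e ≤ 1) : |u * v - u' * v'| ≤ 5 * e := by
  have h0 : 0 ≤ e := (abs_nonneg _).trans hu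
  have h1 : |u| ≤ 3 := by
    have := abs_add_le (u - u') u'
    rw [sub_add_cancel] at this
    linarith
  have : u * v - u' * v' = u * (v - v') + (u - u') * v' := by ring
  rw [this]
  refine (abs_add_le _ _).trans ?_
  rw [abs_mul, abs_mul]
  have h2 := mul_le_mul h1 hv (abs_nonneg _) (by norm_num)
  have h3 := mul_le_mul hu hv' (abs_nonneg _) h0
  linarith

section Rounds

variable {P : Polygon Plane 64}

theorem isConvex_of_rounds (hP : ∀ i, Rounds (P i) (vertexApprox i)) : P.IsConvex := by
  intro i k hki hki'
  have hint : ((10 ^ 12 : ℤ) : ℝ) ≤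
      (intOrient (vertexApprox i) (vertexApprox (i + 1)) (vertexApprox k) : ℤ) :=
    Int.cast_le.2 (le_intOrient_vertexApprox i k hki hki')
  have hi := abs_vertexApprox_le i
  have hj := abs_vertexApprox_le (i + 1)
  have hk := abs_vertexApprox_le k
  have h1 := abs_le.1 (abs_mul_sub_mul_le (abs_sub_sub_le (hP (i + 1)).1 (hP i).1)
    (abs_sub_sub_le (hP k).2 (hP i).2) (abs_int_sub_div_le hj.1 hi.1)
    (abs_int_sub_div_le hk.2 hi.2) (by norm_num))
  have h2 := abs_le.1 (abs_mul_sub_mul_le (abs_sub_sub_le (hP (i + 1)).2 (hP i).2)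
    (abs_sub_sub_le (hP k).1 (hP i).1) (abs_int_sub_div_le hj.2 hi.2)
    (abs_int_sub_div_le hk.1 hi.1) (by norm_num))
  rw [intOrient] at hint
  push_cast at hint
  rw [Polygon.orient]
  norm_num at h1 h2 hint
  linarith [h1.1, h2.2]

theorem dist_lt_one_of_rounds (hP : ∀ i, Rounds (P i) (vertexApprox i)) {i j : Fin 64}
    (h : intDistSq (vertexApprox i) (vertexApprox j) ≤ 10 ^ 16 - 10 ^ 11) :
    dist (P i) (P j) < 1 := by
  have hint : ((intDistSq (vertexApprox i) (vertexApprox j) : ℤ) : ℝ)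
      ≤ ((10 ^ 16 - 10 ^ 11 : ℤ) : ℝ) := Int.cast_le.2 h
  have hi := abs_vertexApprox_le i
  have hj := abs_vertexApprox_le j
  have e1 := abs_sub_sub_le (hP i).1 (hP j).1
  have e2 := abs_sub_sub_le (hP i).2 (hP j).2
  have b1 := abs_int_sub_div_le hi.1 hj.1
  have b2 := abs_int_sub_div_le hi.2 hj.2
  have h1 := abs_le.1 (abs_mul_sub_mul_le e1 e1 b1 b1 (by norm_num))
  have h2 := abs_le.1 (abs_mul_sub_mul_le e2 e2 b2 b2 (by norm_num))
  refine lt_of_pow_lt_pow_left₀ 2 zero_le_one ?_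
  rw [plane_dist_sq]
  rw [intDistSq] at hint
  push_cast at hint
  norm_num at h1 h2 hint
  linarith [h1.2, h2.2]

end Rounds

theorem polygonZ_dist_lt_one_or_adj {t y : ℝ}
    (hP : ∀ i, Rounds (polygonZ t y i) (vertexApprox i)) (i j : Fin 64) :
    dist (polygonZ t y i) (polygonZ t y j) < 1 ∨ graphZ.Adj i j := by
  refine (intDistSq_vertexApprox_le i j).imp (dist_lt_one_of_rounds hP) fun h => ?_
  rwa [graphZ, SimpleGraph.fromRel_adj]

theorem polygonZ_isSmall {t y : ℝ} (hP : ∀ i, Rounds (polygonZ t y i) (vertexApprox i)) :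
    (polygonZ t y).IsSmall := by
  refine ⟨⟨0, 32, (polygonZ_dist_eq_one t y (0, 32) (by decide)).symm⟩, ?_⟩
  rintro d ⟨i, j, rfl⟩
  rcases polygonZ_dist_lt_one_or_adj hP i j with h | h
  · exact h.le
  · exact (polygonZ_dist_eq_one_of_adj h).le

theorem polygonZ_diameterGraph {t y : ℝ}
    (hP : ∀ i, Rounds (polygonZ t y i) (vertexApprox i)) :
    (polygonZ t y).diameterGraph = graphZ := by
  ext i j
  refine ⟨fun h => ?_, fun h => polygonZ_dist_eq_one_of_adj h⟩
  exact (polygonZ_dist_lt_one_or_adj hP i j).resolve_left (not_lt.2 (le_of_eq (Eq.symm h)))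

/-! ### Perimeters -/

/-- The side length at `t₀` is squeezed through its square `2 - 2 cos t₀`. Passing to `t` costs at
most `|t - t₀|`, since `2 sin (t/2)` is 1-Lipschitz. -/
theorem two_sin_half_bounds {t t₀ a b : ℝ} (ht : |t - t₀| ≤ 1 / 10 ^ 15) (h0 : 0 ≤ t₀)
    (h1 : t₀ ≤ Real.pi) (hb : 0 ≤ b) (hal : a ^ 2 ≤ 2 - 2 * Real.cos t₀)
    (hbu : 2 - 2 * Real.cos t₀ ≤ b ^ 2) :
    a - 1 / 10 ^ 15 ≤ 2 * Real.sin (t / 2) ∧ 2 * Real.sin (t / 2) ≤ b + 1 / 10 ^ 15 := by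
  rw [← two_sin_half_sq] at hal hbu
  have hr := two_sin_half_nonneg h0 h1
  have h2 := le_of_pow_le_pow_left₀ two_ne_zero hr hal
  have h3 := le_of_pow_le_pow_left₀ two_ne_zero hb hbu
  have h4 := Real.abs_sin_sub_sin_le (t / 2) (t₀ / 2)
  rw [← sub_div, abs_div, abs_of_pos (zero_lt_two' ℝ)] at h4
  have h5 := abs_le.1 h4
  constructor <;> linarith [h5.1, h5.2]

end

theorem proposition3 :
    ∃ s t y : ℝ,
      -- `s` is the angle that determines `B₆₄`, and `(t, y)` are the parameters of `Z₆₄`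
      (IsAngleB s ∧ ∀ s' : ℝ, IsAngleB s' → s' = s) ∧
      (SystemZ t y ∧ ∀ t' y' : ℝ, SystemZ t' y' → t' = t ∧ y' = y) ∧
      (0.0490873533 ≤ t ∧ t < 0.0490873534) ∧
      -- `Z₆₄` is a convex equilateral small 64-gon with the prescribed diameter graph
      (polygonZ t y).IsConvex ∧
      (polygonZ t y).IsEquilateral ∧
      (polygonZ t y).IsSmall ∧
      (polygonZ t y).diameterGraph = graphZ ∧
      -- the perimeters
      (polygonZ t y).perimeter = 128 * Real.sin (t / 2) ∧
      (3.1412752155 ≤ (polygonZ t y).perimeter ∧ (polygonZ t y).perimeter < 3.1412752156) ∧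
      (3.1412717079 ≤ (polygonB s).perimeter ∧ (polygonB s).perimeter < 3.1412717080) ∧
      (polygonB s).perimeter < (polygonZ t y).perimeter := by
  obtain ⟨s, hs, hsc⟩ := exists_isAngleB
  obtain ⟨t, y, hty, htc⟩ := exists_systemZ
  have hP := polygonZ_rounds hty (approxTable_tableZ.shift htc) (by norm_num)
  have hpi := Real.pi_gt_three
  have hperZ : (polygonZ t y).perimeter = 128 * Real.sin (t / 2) := by
    rw [perimeter_eq (polygonZ_side hty)]; ring
  have hperB : (polygonB s).perimeter = 128 * Real.sin (s / 2) := by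
    rw [perimeter_eq (polygonB_side hs)]; ring
  have hZ : 3.1412752155 ≤ (polygonZ t y).perimeter ∧
      (polygonZ t y).perimeter < 3.1412752156 := by
    have hc := abs_le.1 approxTable_tableZ.cos_one
    norm_num at hc
    -- The decimals enclose the side length at the centre, within `2 · 10⁻¹⁵`. Multiplied by `64`,
    -- this fixes ten decimals of the perimeter.
    have h := two_sin_half_bounds (a := 0.0490824252423643) (b := 0.0490824252423663) htc
      (by norm_num [centerZ]) (by norm_num [centerZ]; linarith) (by norm_num)
      (by norm_num; linarith [hc.2]) (by norm_num; linarith [hc.1])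
    rw [hperZ]
    norm_num at h ⊢
    constructor <;> linarith [h.1, h.2]
  have hB : 3.1412717079 ≤ (polygonB s).perimeter ∧ (polygonB s).perimeter < 3.1412717080 := by
    have hc := abs_le.1 approxTable_tableB.cos_oneB
    norm_num at hc
    have h := two_sin_half_bounds (a := 0.0490823704360257) (b := 0.0490823704360277) hsc
      (by norm_num [centerB]) (by norm_num [centerB]; linarith) (by norm_num)
      (by norm_num; linarith [hc.2]) (by norm_num; linarith [hc.1])
    rw [hperB]
    norm_num at h ⊢
    constructor <;> linarith [h.1, h.2]
  refine ⟨s, t, y, ⟨hs, fun s' hs' => isAngleB_unique hs hs'⟩,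
    ⟨hty, fun t' y' h => systemZ_unique hty h⟩, ?_, isConvex_of_rounds hP,
    ⟨_, polygonZ_side hty⟩, polygonZ_isSmall hP, polygonZ_diameterGraph hP, hperZ, hZ, hB,
    lt_of_lt_of_le hB.2 (le_trans (by norm_num) hZ.1)⟩
  rw [abs_le, centerZ] at htc
  norm_num at htc ⊢
  constructor <;> linarith [htc.1, htc.2]
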